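/- Setting. Let $\Omega\subseteq\mathbb R^m$ be closed and convex, let $f(\cdot;z)$, $z\in\mathcal Z$, be real-valued losses, $\mathcal S=(z_1,\dots,z_n)\in\mathcal Z^n$, $F_{\mathcal S}(x)=\frac1n\sum_{i=1}^n f(x;z_i)$, and let $x_*\in\Omega$ be a minimizer of $F_{\mathcal S}$ over $\Omega$. Assume, with constants $G$ and $L,\rho,\mu,\epsilon_0>0$: (i) $\|\nabla f(x;z)\|^2\le G^2$ for all $x\in\Omega$, $z\in\mathcal Z$; (ii) $f(\cdot;z)$ is $\rho$-weakly convex on $\Omega$, i.e. $f(\cdot;z)+\frac\rho2\|\cdot\|^2$ is convex on $\Omega$, for all $z$; (iii) $f(\cdot;z)$ is $L$-smooth on $\Omega$ (differentiable with $L$-Lipschitz gradient) for all $z$; (iv) the initial point $x_0\in\Omega$ satisfies $F_{\mathcal S}(x_0)-F_{\mathcal S}(x_*)\le\epsilon_0$; (v) the PL condition for the minimization of $F_{\mathcal S}$ over $\Omega$: $2\mu\,(F_{\mathcal S}(x)-F_{\mathcal S}(x_*))\le\|\nabla F_{\mathcal S}(x)+v\|^2$ for all $x\in\Omega$ and all $v$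 in the normal cone $N_\Omega(x)=\{v:\langle v,y-x\rangle\le0\ \ \forall y\in\Omega\}$ (at interior points of $\Omega$, and everywhere if $\Omega=\mathbb R^m$, this is $2\mu(F_{\mathcal S}(x)-F_{\mathcal S}(x_*))\le\|\nabla F_{\mathcal S}(x)\|^2$); (vi) $\rho\le\mu/4$. Algorithm. Let $\alpha\ge0$, $\delta\in(0,1)$, $\epsilon_k=\epsilon_0/2^k$, $\gamma=4/\mu$, $D_k=\sqrt{\epsilon_{k-1}/\mu}$. Stage $k=1,2,\dots$ applies SGD to $F_k(x)=F_{\mathcal S}(x)+\frac1{2\gamma}\|x-x_{k-1}\|^2$: put $x^k_1=x_{k-1}$ and, for $1\le t<T_k$, $x^k_{t+1}=\Pi_k\big[x^k_t-\eta_k\big(\nabla f(x^k_t;z_{i^k_t})+\gamma^{-1}(x^k_t-x_{k-1})\big)\big]$, where $\Pi_k$ is the Euclidean projection onto $\{x\in\Omega:\|x-x_{k-1}\|\le D_k\}$ and all indices $i^k_t$ are independent and uniform on $\{1,\dots,n\}$; the output of the stage is $x_k=\sum_{t=1}^{T_k}t^\alpha x^k_t\big/\sum_{t=1}^{T_k}t^\alpha$.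 The parameters are $\eta_k=\frac{\epsilon_k c}{2\hat G^2}$ (which is $\le 1/L$) and $T_k=\big\lceil\frac{d}{\mu\epsilon_k}\big\rceil$, where $\hat G>0$, $\hat G^2\ge 2G^2+2\gamma^{-2}D_1^2$, $0<c\le\min\big(1,\frac{2\hat G^2}{L\epsilon_0}\big)$ and $d=\max\big\{\frac{32(\alpha+1)\hat G^2}{c},\,512(\alpha+1)^2\hat G^2\ln(1/\delta)\big\}$. Theorem. For every $\epsilon>0$, after $K=\max\{0,\lceil\log_2(\epsilon_0/\epsilon)\rceil\}$ stages, with probability at least $(1-\delta)^K$, $$F_{\mathcal S}(x_K)-F_{\mathcal S}(x_*)\le\epsilon ,$$ and the total number of iterations is $O\big(\frac{\alpha+1}{\mu\epsilon}\big)$ in the explicit form $$\sum_{k=1}^K T_k\ \le\ 5\,\hat G^2\max\Big\{\frac{32}{c},\,512(\alpha+1)\ln(1/\delta)\Big\}\cdot\frac{\alpha+1}{\mu\epsilon}.$$ -/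

import Mathlib

open MeasureTheory ProbabilityTheory
open scoped Gradient

namespace PIWA

noncomputable section

/-- `ℝ^m` with the Euclidean norm. -/
abbrev Vec (m : ℕ) : Type := EuclideanSpace ℝ (Fin m)

/-- The empirical risk `F_S x = (1/n) ∑ i, f (x; z i)` of the data set `S = (z i)`;
`f z x` is the loss of the model `x` on the data point `z`. -/
def empRisk {m n : ℕ} {Z : Type*} (f : Z → Vec m → ℝ) (S : Fin n → Z) (x : Vec m) : ℝ :=
  (1 / (n : ℝ)) * ∑ i, f (S i) x

/-- `g` is differentiable at the points of `Ω` and its gradient is `L`-Lipschitz on `Ω`. -/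
def SmoothOn {m : ℕ} (L : ℝ) (Ω : Set (Vec m)) (g : Vec m → ℝ) : Prop :=
  (∀ x ∈ Ω, DifferentiableAt ℝ g x) ∧
    ∀ x ∈ Ω, ∀ y ∈ Ω, ‖∇ g x - ∇ g y‖ ≤ L * ‖x - y‖

/-- `g` is `ρ`-weakly convex on `Ω`: `g + (ρ/2) ‖·‖²` is convex there. -/
def WeaklyConvexOn {m : ℕ} (ρ : ℝ) (Ω : Set (Vec m)) (g : Vec m → ℝ) : Prop :=
  ConvexOn ℝ Ω fun x => g x + ρ / 2 * ‖x‖ ^ 2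

/-- The normal cone of `Ω` at `x`; it is `{0}` at every interior point of `Ω`. -/
def normalCone {m : ℕ} (Ω : Set (Vec m)) (x : Vec m) : Set (Vec m) :=
  {v | ∀ y ∈ Ω, inner ℝ v (y - x) ≤ 0}

/-- The Polyak-Lojasiewicz condition with constant `μ` for minimizing `F` over `Ω`, where `xs` is
a minimizer: `2 μ (F x - F xs) ≤ ‖g‖²` for all `x ∈ Ω` and all subgradients
`g ∈ ∇ F x + normalCone Ω x` of `F` plus the indicator function of `Ω`. At interior points of `Ω`
this says `2 μ (F x - F xs) ≤ ‖∇ F x‖²`. -/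
def PLOn {m : ℕ} (μ : ℝ) (Ω : Set (Vec m)) (F : Vec m → ℝ) (xs : Vec m) : Prop :=
  ∀ x ∈ Ω, ∀ v ∈ normalCone Ω x, 2 * μ * (F x - F xs) ≤ ‖∇ F x + v‖ ^ 2

/-- The Euclidean projection onto `C` (for `C` nonempty, closed and convex): the point of `C`
that is closest to `x`. -/
def proj {m : ℕ} (C : Set (Vec m)) (x : Vec m) : Vec m :=
  Classical.epsilon fun v => v ∈ C ∧ ∀ w ∈ C, ‖x - v‖ ≤ ‖x - w‖

theorem proj_spec {m : ℕ} {C : Set (Vec m)} (hne : C.Nonempty) (hC : IsClosed C) (x : Vec m) :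
    proj C x ∈ C ∧ ∀ w ∈ C, ‖x - proj C x‖ ≤ ‖x - w‖ := by
  refine Classical.epsilon_spec (p := fun v => v ∈ C ∧ ∀ w ∈ C, ‖x - v‖ ≤ ‖x - w‖) ?_
  obtain ⟨v, hv, h⟩ := hC.exists_infDist_eq_dist hne x
  refine ⟨v, hv, fun w hw => ?_⟩
  rw [← dist_eq_norm, ← dist_eq_norm, ← h]
  exact Metric.infDist_le_dist_of_mem hw

/-- Projected SGD with constant step size `η` on the average of the functions `h i`, started at
`y`, where `idx t` is the index sampled in the `t`-th iteration. `sgdIter h idx η C y t` is the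
`(t+1)`-st solution. -/
def sgdIter {m n : ℕ} (h : Fin n → Vec m → ℝ) (idx : ℕ → Fin n) (η : ℝ) (C : Set (Vec m))
    (y : Vec m) : ℕ → Vec m
  | 0 => y
  | t + 1 =>
      proj C (sgdIter h idx η C y t - η • ∇ (h (idx t)) (sgdIter h idx η C y t))

/-- SGD with polynomially increased weighted averaging: run projected SGD to get the solutions
number `1, …, T` and return their average, where the `t`-th has weight `t ^ α`. -/
def sgdPIWA {m n : ℕ} (α : ℝ) (h : Fin n → Vec m → ℝ) (idx : ℕ → Fin n) (y : Vec m) (η : ℝ)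
    (T : ℕ) (C : Set (Vec m)) : Vec m :=
  (∑ t ∈ Finset.range T, ((t + 1 : ℕ) : ℝ) ^ α)⁻¹ •
    ∑ t ∈ Finset.range T, ((t + 1 : ℕ) : ℝ) ^ α • sgdIter h idx η C y t

/-- The stagewise algorithm. Stage `k + 1` runs SGD-PIWA from the output `y` of stage `k` on
`F_S + (1/(2γ)) ‖· - y‖²`, the average of the functions `f (·; z j) + (1/(2γ)) ‖· - y‖²`, with
step size `η (k+1)`, for `T (k+1)` iterations, over `{x ∈ Ω | ‖x - y‖ ≤ D (k+1)}`.
`idx k t` is the index sampled in iteration `t` of stage `k`. -/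
def stagewise {m n : ℕ} {Z : Type*} (f : Z → Vec m → ℝ) (S : Fin n → Z) (Ω : Set (Vec m))
    (α γ : ℝ) (η D : ℕ → ℝ) (T : ℕ → ℕ) (x0 : Vec m) (idx : ℕ → ℕ → Fin n) : ℕ → Vec m
  | 0 => x0
  | k + 1 =>
      sgdPIWA α
        (fun j x => f (S j) x + 1 / (2 * γ) * ‖x - stagewise f S Ω α γ η D T x0 idx k‖ ^ 2)
        (idx (k + 1)) (stagewise f S Ω α γ η D T x0 idx k) (η (k + 1)) (T (k + 1))
        {x | x ∈ Ω ∧ ‖x - stagewise f S Ω α γ η D T x0 idx k‖ ≤ D (k + 1)}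

end

end PIWA

/-!
Every stage halves the bound on the optimality gap, with conditional probability of success at
least `1 - δ`; multiplying
these probabilities over the stages gives the confidence, and the numbers of iterations form a
geometric sum.

Consider a stage with target `e` that starts at `y`, where the gap is at most `2 e`. Weak convexity
with `ρ ≤ μ / 4` makes the regularised objective `H = F + (μ / 8) ‖· - y‖²` convex. The ball of
radius `D = √(2 e / μ)` around `y` need not contain a minimizer of `F`: the PL condition only
bounds the distance to the minimizers by `√2 * D`. What is true is that `√(F - min F)` can be
decreased at any rate below `√(μ / 2)` per unit of length (`exists_descent_of_PLOn`), by a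
variational argument at a minimizer of `√(F - min F) + κ ‖· - y‖`. So the ball contains a point
with `H - min F ≤ 0.43 e` (`stage_min_sub_le`), and the minimizer `u` of `H` over the ball
satisfies the same bound.

The regret of projected SGD against `u` is a deterministic error plus the weighted sum of the
noise of the stochastic gradients (`stage_regret_le`). The deterministic error is at most `e / 2`,
and at most `13 e / 32` if `log (1 / δ) ≥ 1 / 10` (`stage_error_le`). In the latter case the noise
is at most `e / 8` with probability `1 - δ`, by Hoeffding's lemma and an exponential supermartingale
argument (`IsAdaptedNoise.measureReal_le_exp`), and `0.43 + 13 / 32 + 1 / 8 < 1`. In the other case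
`δ ≥ 9 / 10`, and the nonnegative gap of `H` to `H u` has expectation at most `e / 2`, so by
Markov's inequality it exceeds `0.57 e` with probability at most `0.5 / 0.57 < δ`
(`IsAdaptedNoise.mul_measureReal_le`).

All random quantities are functions of an array of indices that depend on finitely many entries
(`DependsOn`), and conditioning on the past becomes averaging out one index at a time
(`integral_eq_integral_avg`).
-/

namespace PIWA

/-! ### Projections, gradients and convexity -/

theorem inner_sub_proj_le {m : ℕ} {C : Set (Vec m)} (hne : C.Nonempty) (hC : IsClosed C)
    (hconv : Convex ℝ C) (x : Vec m) {u : Vec m} (hu : u ∈ C) :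
    inner ℝ (x - proj C x) (u - proj C x) ≤ 0 := by
  obtain ⟨hmem, hle⟩ := proj_spec hne hC x
  refine (norm_eq_iInf_iff_real_inner_le_zero hconv hmem).1 ?_ u hu
  have : Nonempty C := ⟨⟨u, hu⟩⟩
  exact le_antisymm (le_ciInf fun w => hle w w.2)
    (ciInf_le ⟨0, by rintro _ ⟨w, rfl⟩; exact norm_nonneg _⟩ (⟨_, hmem⟩ : C))

theorem norm_proj_sub_sq_le {m : ℕ} {C : Set (Vec m)} (hne : C.Nonempty) (hC : IsClosed C)
    (hconv : Convex ℝ C) (x : Vec m) {u : Vec m} (hu : u ∈ C) :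
    ‖proj C x - u‖ ^ 2 ≤ ‖x - u‖ ^ 2 := by
  have h := inner_sub_proj_le hne hC hconv x hu
  have e : x - u = (x - proj C x) - (u - proj C x) := by abel
  rw [e, norm_sub_sq_real (x - proj C x), norm_sub_rev (proj C x) u]
  nlinarith [sq_nonneg ‖x - proj C x‖]

theorem hasDerivAt_line {m : ℕ} {g : Vec m → ℝ} {x g' : Vec m} (hg : HasGradientAt g g' x)
    (v : Vec m) : HasDerivAt (fun t : ℝ => g (x + t • v)) (inner ℝ g' v) 0 := by
  have h1 : HasDerivAt (fun t : ℝ => x + t • v) v 0 := by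
    simpa using ((hasDerivAt_id (0 : ℝ)).smul_const v).const_add x
  have h2 : HasFDerivAt g (InnerProductSpace.toDual ℝ (Vec m) g') (x + (0 : ℝ) • v) := by
    simpa using hg.hasFDerivAt
  have h3 := h2.comp_hasDerivAt (0 : ℝ) h1
  rwa [InnerProductSpace.toDual_apply_apply] at h3

/-- A function of one variable that does not go below its value at `0` on a right neighbourhood
of `0` has a nonnegative derivative there. -/
theorem deriv_nonneg_of_min_right {φ : ℝ → ℝ} {φ' r : ℝ} (hr : 0 < r) (hφ : HasDerivAt φ φ' 0)
    (h : ∀ t, 0 < t → t < r → φ 0 ≤ φ t) : 0 ≤ φ' := by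
  refine ge_of_tendsto hφ.tendsto_slope_zero_right ?_
  filter_upwards [Ioo_mem_nhdsGT hr] with t ht
  have := h t ht.1 ht.2
  simp only [zero_add, smul_eq_mul]
  exact mul_nonneg (inv_nonneg.2 ht.1.le) (by linarith)

/-- The first-order inequality of a convex function. -/
theorem sub_le_inner_of_convexOn {m : ℕ} {g : Vec m → ℝ} {Ω : Set (Vec m)} (hg : ConvexOn ℝ Ω g)
    {x u g' : Vec m} (hx : x ∈ Ω) (hu : u ∈ Ω) (hg' : HasGradientAt g g' x) :
    g x - g u ≤ inner ℝ g' (x - u) := by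
  have hd : HasDerivAt (fun t : ℝ => g x + t * (g u - g x) - g (x + t • (u - x)))
      (g u - g x - inner ℝ g' (u - x)) 0 := by
    have h1 : HasDerivAt (fun t : ℝ => g x + t * (g u - g x)) (g u - g x) 0 := by
      simpa using ((hasDerivAt_id (0 : ℝ)).mul_const (g u - g x)).const_add (g x)
    exact h1.sub (hasDerivAt_line hg' (u - x))
  have h := deriv_nonneg_of_min_right one_pos hd fun t ht0 ht1 => by
    have := hg.2 hx hu (sub_nonneg.2 ht1.le) ht0.le (by ring)
    have e : (1 - t) • x + t • u = x + t • (u - x) := by module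
    rw [e] at this
    simp only [smul_eq_mul] at this
    simp only [zero_mul, zero_smul, add_zero]
    linarith
  have e : inner ℝ g' (x - u) = - inner ℝ g' (u - x) := by rw [← inner_neg_right, neg_sub]
  linarith

/-- The gradient of a function regularised by a multiple of the squared distance. -/
theorem hasGradientAt_add_sq {m : ℕ} {g : Vec m → ℝ} {g' x : Vec m} (hg : HasGradientAt g g' x)
    (b : ℝ) (y : Vec m) :
    HasGradientAt (fun x => g x + b * ‖x - y‖ ^ 2) (g' + (2 * b) • (x - y)) x := by
  have h1 : HasFDerivAt (fun x : Vec m => ‖x - y‖ ^ 2) (2 • (innerSL ℝ (x - y))) x := by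
    simpa using ((hasFDerivAt_id x).sub_const y).norm_sq
  have h2 := hg.hasFDerivAt.add (h1.const_mul b)
  rw [hasGradientAt_iff_hasFDerivAt]
  have e : InnerProductSpace.toDual ℝ (Vec m) (g' + (2 * b) • (x - y)) =
      InnerProductSpace.toDual ℝ (Vec m) g' + b • 2 • innerSL ℝ (x - y) := by
    ext v
    simp only [InnerProductSpace.toDual_apply_apply, inner_add_left, real_inner_smul_left,
      add_apply, smul_apply, innerSL_apply_apply,
      smul_eq_mul, nsmul_eq_mul]
    push_cast
    ring
  rw [e]
  exact h2

theorem hasGradientAt_empRisk {m n : ℕ} {Z : Type*} {f : Z → Vec m → ℝ} {S : Fin n → Z}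
    {x : Vec m} (hf : ∀ z, DifferentiableAt ℝ (f z) x) :
    HasGradientAt (empRisk f S) ((1 / (n : ℝ)) • ∑ i, ∇ (f (S i)) x) x := by
  rw [hasGradientAt_iff_hasFDerivAt]
  have h := (HasFDerivAt.fun_sum (u := Finset.univ) fun i _ =>
    (hf (S i)).hasGradientAt.hasFDerivAt).const_mul (1 / (n : ℝ))
  rwa [map_smul, map_sum]

/-- Averages of `ρ`-weakly convex functions become convex when regularised by `b ‖· - y‖²` with
`ρ / 2 ≤ b`. -/
theorem convexOn_empRisk_add_sq {m n : ℕ} {Z : Type*} {f : Z → Vec m → ℝ} {S : Fin n → Z}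
    {Ω : Set (Vec m)} {ρ b : ℝ} (hn : 0 < n) (hf : ∀ z, WeaklyConvexOn ρ Ω (f z))
    (hΩ : Convex ℝ Ω) (hb : ρ / 2 ≤ b) (y : Vec m) :
    ConvexOn ℝ Ω fun x => empRisk f S x + b * ‖x - y‖ ^ 2 := by
  have hsq : ConvexOn ℝ Ω fun x : Vec m => ‖x‖ ^ 2 :=
    ((convexOn_norm hΩ).pow (fun _ _ => norm_nonneg _) 2)
  have h1 : ConvexOn ℝ Ω fun x => ∑ i, (f (S i) x + ρ / 2 * ‖x‖ ^ 2) := by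
    have : ∀ s : Finset (Fin n), ConvexOn ℝ Ω fun x => ∑ i ∈ s, (f (S i) x + ρ / 2 * ‖x‖ ^ 2) := by
      intro s
      induction s using Finset.induction_on with
      | empty => simpa using convexOn_const 0 hΩ
      | insert a s ha ih => simp only [Finset.sum_insert ha]; exact (hf (S a)).add ih
    exact this _
  have h2 := (h1.smul (c := 1 / (n : ℝ)) (by positivity)).add
    (hsq.smul (sub_nonneg.2 hb))
  have h3 : ConvexOn ℝ Ω fun x : Vec m => b * ‖y‖ ^ 2 - 2 * b * inner ℝ y x := by
    refine ⟨hΩ, fun u _ v _ s t _ _ hst => le_of_eq ?_⟩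
    simp only [inner_add_right, inner_smul_right, smul_eq_mul]
    linear_combination (-b * ‖y‖ ^ 2) * hst
  refine (h2.add h3).congr fun x _ => ?_
  have hn' : (n : ℝ) ≠ 0 := by positivity
  simp only [Pi.add_apply, smul_eq_mul, empRisk, norm_sub_sq_real, Finset.sum_add_distrib,
    Finset.sum_const, Finset.card_univ, Fintype.card_fin, nsmul_eq_mul, real_inner_comm x y]
  field_simp
  ring

/-! ### Descent under the Polyak-Lojasiewicz condition -/

/-- If the slope of the linear form `⟨g, ·⟩` towards all points of `Ω` is at least `-b`, then a
vector of norm at most `b` lies in `g + normalCone Ω y`. It is found by projecting `-g` onto the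
tangent cone (the closure of the cone of feasible directions). -/
theorem exists_mem_normalCone_norm_add_le {m : ℕ} {Ω : Set (Vec m)} (hΩ : Convex ℝ Ω) {y : Vec m}
    (hy : y ∈ Ω) {g : Vec m} {b : ℝ} (h : ∀ u ∈ Ω, -(b * ‖u - y‖) ≤ inner ℝ g (u - y))
    (hb : 0 ≤ b) : ∃ v ∈ normalCone Ω y, ‖g + v‖ ≤ b := by
  set A : Set (Vec m) := (fun u => u - y) '' Ω with hA
  have hAconv : Convex ℝ A := by
    have e : A = (fun u => -y + u) '' Ω := Set.image_congr fun u _ => by abel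
    rw [e]
    exact hΩ.translate (-y)
  set K : ConvexCone ℝ (Vec m) := (ConvexCone.hull ℝ A).closure with hK
  have hKc : IsClosed (K : Set (Vec m)) := by simp [hK]
  have hsub : ∀ u ∈ Ω, u - y ∈ K := fun u hu =>
    subset_closure (ConvexCone.subset_hull ⟨u, hu, rfl⟩)
  have h0 : (0 : Vec m) ∈ K := by simpa using hsub y hy
  have hKle : ∀ w ∈ K, -(b * ‖w‖) ≤ inner ℝ g w := by
    have hcl : IsClosed {w : Vec m | -(b * ‖w‖) ≤ inner ℝ g w} :=
      isClosed_le (by fun_prop) (by fun_prop)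
    intro w hw
    refine closure_minimal ?_ hcl hw
    intro w hw
    obtain ⟨c, hc, w', ⟨u, hu, rfl⟩, rfl⟩ := (ConvexCone.mem_hull_of_convex hAconv).1 hw
    have := mul_le_mul_of_nonneg_left (h u hu) hc.le
    simp only [Set.mem_ofPred_eq, norm_smul, inner_smul_right, Real.norm_eq_abs, abs_of_pos hc]
    linarith
  set p := proj (K : Set (Vec m)) (-g) with hp
  have hpK : p ∈ K := (proj_spec ⟨0, h0⟩ hKc (-g)).1
  have hin : ∀ w ∈ K, inner ℝ (-g - p) (w - p) ≤ 0 := fun w hw =>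
    inner_sub_proj_le ⟨0, h0⟩ hKc K.convex (-g) hw
  refine ⟨-g - p, fun u hu => ?_, ?_⟩
  · have := hin _ (K.add_mem (hsub u hu) hpK)
    simpa using this
  · have h1 := hin 0 h0
    have h2 := hKle p hpK
    have e : g + (-g - p) = -p := by abel
    rw [e, norm_neg]
    simp only [zero_sub, inner_neg_right, inner_sub_left, inner_neg_left,
      real_inner_self_eq_norm_sq] at h1
    by_contra hlt
    push Not at hlt
    nlinarith [norm_nonneg p]

/-- Under the PL condition, `√(F - F xs)` can be decreased at the rate `κ` per unit of length, for
every `κ < √(μ/2)`: within distance `r` of `x` there is either a minimizer or a point where it is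
smaller by `κ r`. The point minimizes `√(F - F xs) + κ ‖· - x‖` over the part of `Ω` in the closed
ball around `x`; at a minimizer inside the ball that is not a minimizer of `F`, stationarity would
contradict the PL condition. -/
theorem exists_descent_of_PLOn {m : ℕ} {Ω : Set (Vec m)} (hΩc : IsClosed Ω) (hΩ : Convex ℝ Ω)
    {F : Vec m → ℝ} (hF : ∀ x ∈ Ω, DifferentiableAt ℝ F x) {xs : Vec m}
    (hmin : IsMinOn F Ω xs) {μ κ r : ℝ} (hPL : PLOn μ Ω F xs) (hκ0 : 0 < κ)
    (hκ : 2 * κ ^ 2 < μ) (hr : 0 ≤ r) {x : Vec m} (hx : x ∈ Ω) :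
    ∃ y ∈ Ω, ‖y - x‖ ≤ r ∧ (F y = F xs ∨ √(F y - F xs) + κ * r ≤ √(F x - F xs)) := by
  have hcomp : IsCompact (Ω ∩ Metric.closedBall x r) :=
    (isCompact_closedBall x r).inter_left hΩc
  have hFc : ContinuousOn F Ω := fun z hz => (hF z hz).continuousAt.continuousWithinAt
  have hcont : ContinuousOn (fun z => √(F z - F xs) + κ * ‖z - x‖) (Ω ∩ Metric.closedBall x r) :=
    ((hFc.mono Set.inter_subset_left).sub continuousOn_const).sqrt.add (by fun_prop)
  obtain ⟨y, ⟨hyΩ, hyr⟩, hymin⟩ :=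
    hcomp.exists_isMinOn ⟨x, hx, Metric.mem_closedBall_self hr⟩ hcont
  rw [mem_closedBall_iff_norm] at hyr
  refine ⟨y, hyΩ, hyr, ?_⟩
  rcases hyr.eq_or_lt with heq | hlt
  · right
    have := hymin ⟨hx, Metric.mem_closedBall_self hr⟩
    simpa [heq] using this
  left
  by_contra hne
  have hpos : 0 < F y - F xs := sub_pos.2 (lt_of_le_of_ne (hmin hyΩ) (Ne.symm hne))
  set s := √(F y - F xs) with hs
  have hs0 : 0 < s := Real.sqrt_pos.2 hpos
  have hslope : ∀ u ∈ Ω, -(2 * κ * s * ‖u - y‖) ≤ inner ℝ (∇ F y) (u - y) := by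
    intro u hu
    have hd : HasDerivAt (fun t : ℝ => √(F (y + t • (u - y)) - F xs) + t * (κ * ‖u - y‖))
        (inner ℝ (∇ F y) (u - y) / (2 * s) + κ * ‖u - y‖) 0 := by
      have h1 := ((hasDerivAt_line (hF y hyΩ).hasGradientAt (u - y)).sub_const (F xs)).sqrt
        (by simpa using hpos.ne')
      have h2 := (hasDerivAt_id (0 : ℝ)).mul_const (κ * ‖u - y‖)
      have h3 := h1.add h2
      simp only [zero_smul, add_zero, one_mul] at h3
      exact h3
    have hδ : 0 < min 1 ((r - ‖y - x‖) / (‖u - y‖ + 1)) :=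
      lt_min one_pos (div_pos (by linarith) (by positivity))
    have := deriv_nonneg_of_min_right hδ hd fun t ht0 ht => by
      have ht1 : t < 1 := ht.trans_le (min_le_left _ _)
      have ht2 := (lt_div_iff₀ (by positivity)).1 (ht.trans_le (min_le_right _ _))
      have hmem : y + t • (u - y) ∈ Ω := hΩ.add_smul_sub_mem hyΩ hu ⟨ht0.le, ht1.le⟩
      have htri : ‖y + t • (u - y) - x‖ ≤ ‖y - x‖ + t * ‖u - y‖ := by
        have e : y + t • (u - y) - x = (y - x) + t • (u - y) := by abel
        rw [e]
        refine (norm_add_le _ _).trans_eq ?_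
        rw [norm_smul, Real.norm_eq_abs, abs_of_pos ht0]
      have := hymin ⟨hmem, mem_closedBall_iff_norm.2 (by nlinarith)⟩
      simp only [Set.mem_ofPred_eq] at this
      simp only [zero_smul, add_zero, zero_mul]
      nlinarith
    rw [div_add' _ _ _ (by positivity), div_nonneg_iff] at this
    rcases this with h | h
    · linarith [h.1]
    · nlinarith [h.2]
  obtain ⟨v, hv, hle⟩ := exists_mem_normalCone_norm_add_le hΩ hyΩ hslope (by positivity)
  have h1 := hPL y hyΩ v hv
  have h2 : ‖∇ F y + v‖ ^ 2 ≤ (2 * κ * s) ^ 2 := pow_le_pow_left₀ (norm_nonneg _) hle 2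
  have h3 : s ^ 2 = F y - F xs := Real.sq_sqrt hpos.le
  rw [← h3] at h1 hpos
  nlinarith

/-! ### Projected SGD with polynomially increasing weights -/

theorem sgdIter_mem {m n : ℕ} {h : Fin n → Vec m → ℝ} {idx : ℕ → Fin n} {η : ℝ}
    {C : Set (Vec m)} (hC : IsClosed C) {y : Vec m} (hy : y ∈ C) (t : ℕ) :
    sgdIter h idx η C y t ∈ C := by
  cases t with
  | zero => exact hy
  | succ t => exact (proj_spec ⟨y, hy⟩ hC _).1

theorem sgdIter_congr {m n : ℕ} {h : Fin n → Vec m → ℝ} {i j : ℕ → Fin n} {η : ℝ}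
    {C : Set (Vec m)} {y : Vec m} {t : ℕ} (hij : ∀ t' < t, i t' = j t') :
    sgdIter h i η C y t = sgdIter h j η C y t := by
  induction t with
  | zero => rfl
  | succ t ih =>
    simp only [sgdIter, ih fun t' ht' => hij t' (ht'.trans t.lt_succ_self),
      hij t t.lt_succ_self]

theorem sgdPIWA_congr {m n : ℕ} {α : ℝ} {h : Fin n → Vec m → ℝ} {i j : ℕ → Fin n} {η : ℝ}
    {C : Set (Vec m)} {y : Vec m} {T : ℕ} (hij : ∀ t < T, i t = j t) :
    sgdPIWA α h i y η T C = sgdPIWA α h j y η T C := by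
  unfold sgdPIWA
  congr 1
  refine Finset.sum_congr rfl fun t ht => ?_
  rw [sgdIter_congr fun t' ht' => hij t' (ht'.trans (Finset.mem_range.1 ht))]

/-- The weighted regret of projected SGD against `u`, for nondecreasing weights, in terms of the
noise `g (x t) - ∇ (h (idx t)) (x t)`. The telescoping sum of the squared distances to `u` is
bounded by summation by parts. -/
theorem sum_regret_le {m n : ℕ} {h : Fin n → Vec m → ℝ} {idx : ℕ → Fin n} {η : ℝ}
    {C : Set (Vec m)} (hC : IsClosed C) (hconv : Convex ℝ C) {y u : Vec m} (hy : y ∈ C)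
    (hu : u ∈ C) (hη : 0 < η) {Γ A : ℝ} (hΓ : ∀ i, ∀ x ∈ C, ‖∇ (h i) x‖ ^ 2 ≤ Γ)
    (hA : ∀ x ∈ C, ‖x - u‖ ^ 2 ≤ A) {H : Vec m → ℝ} {g : Vec m → Vec m}
    (hH : ∀ x ∈ C, H x - H u ≤ inner ℝ (g x) (x - u)) {w : ℕ → ℝ} (hw0 : ∀ t, 0 ≤ w t)
    (hw : Monotone w) (T : ℕ) :
    ∑ t ∈ Finset.range (T + 1), w t * (H (sgdIter h idx η C y t) - H u) ≤
      w T * A / (2 * η) + η * Γ / 2 * ∑ t ∈ Finset.range (T + 1), w t +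
        ∑ t ∈ Finset.range (T + 1), w t *
          inner ℝ (g (sgdIter h idx η C y t) - ∇ (h (idx t)) (sgdIter h idx η C y t))
            (sgdIter h idx η C y t - u) := by
  set x := sgdIter h idx η C y with hxdef
  have hx : ∀ t, x t ∈ C := fun t => sgdIter_mem hC hy t
  have step : ∀ t, w t * (H (x t) - H u) ≤
      w t * ‖x t - u‖ ^ 2 / (2 * η) - w t * ‖x (t + 1) - u‖ ^ 2 / (2 * η) + η * Γ / 2 * w t +
        w t * inner ℝ (g (x t) - ∇ (h (idx t)) (x t)) (x t - u) := by
    intro t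
    have h1 : ‖x (t + 1) - u‖ ^ 2 ≤ ‖x t - η • ∇ (h (idx t)) (x t) - u‖ ^ 2 :=
      norm_proj_sub_sq_le ⟨y, hy⟩ hC hconv _ hu
    have e : x t - η • ∇ (h (idx t)) (x t) - u = (x t - u) - η • ∇ (h (idx t)) (x t) := by abel
    rw [e, norm_sub_sq_real (x t - u), inner_smul_right, norm_smul, mul_pow, Real.norm_eq_abs, sq_abs,
      real_inner_comm] at h1
    have h2 := hΓ (idx t) (x t) (hx t)
    have h3 := hH (x t) (hx t)
    have h4 : inner ℝ (∇ (h (idx t)) (x t)) (x t - u) ≤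
        (‖x t - u‖ ^ 2 - ‖x (t + 1) - u‖ ^ 2) / (2 * η) + η * Γ / 2 := by
      rw [div_add' _ _ _ (by positivity), le_div_iff₀ (by positivity)]
      nlinarith [mul_le_mul_of_nonneg_left h2 (sq_nonneg η)]
    rw [inner_sub_left]
    have := mul_le_mul_of_nonneg_left (h3.trans (by linarith : _ ≤
      (‖x t - u‖ ^ 2 - ‖x (t + 1) - u‖ ^ 2) / (2 * η) + η * Γ / 2 +
        (inner ℝ (g (x t)) (x t - u) - inner ℝ (∇ (h (idx t)) (x t)) (x t - u)))) (hw0 t)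
    refine this.trans_eq ?_
    ring
  have main : ∑ t ∈ Finset.range (T + 1), w t * (H (x t) - H u) +
        w T * ‖x (T + 1) - u‖ ^ 2 / (2 * η) ≤
      w T * A / (2 * η) + η * Γ / 2 * ∑ t ∈ Finset.range (T + 1), w t +
        ∑ t ∈ Finset.range (T + 1), w t *
          inner ℝ (g (x t) - ∇ (h (idx t)) (x t)) (x t - u) := by
    induction T with
    | zero =>
      have h1 := step 0
      have h2 : w 0 * ‖x 0 - u‖ ^ 2 / (2 * η) ≤ w 0 * A / (2 * η) := by
        have := mul_le_mul_of_nonneg_left (hA _ (hx 0)) (hw0 0)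
        gcongr
      simp only [zero_add, Finset.sum_range_one]
      linarith
    | succ T ih =>
      have h1 := step (T + 1)
      have h2 : w T * A / (2 * η) +
            (w (T + 1) - w T) * ‖x (T + 1) - u‖ ^ 2 / (2 * η) ≤ w (T + 1) * A / (2 * η) := by
        rw [← add_div]
        have := mul_le_mul_of_nonneg_left (hA _ (hx (T + 1))) (sub_nonneg.2 (hw T.le_succ))
        gcongr
        linarith
      rw [Finset.sum_range_succ, Finset.sum_range_succ _ (T + 1), Finset.sum_range_succ _ (T + 1)]
      rw [sub_mul, sub_div] at h2
      linarith
  have : 0 ≤ w T * ‖x (T + 1) - u‖ ^ 2 / (2 * η) := by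
    have := hw0 T
    positivity
  linarith

/-- The last weight `T ^ α` is at most `(α + 1) / T` times the sum of the weights. -/
theorem mul_rpow_le_sum_rpow {α : ℝ} (hα : 0 ≤ α) (T : ℕ) :
    ((T : ℝ) + 1) * ((T + 1 : ℕ) : ℝ) ^ α ≤
      (α + 1) * ∑ t ∈ Finset.range (T + 1), ((t + 1 : ℕ) : ℝ) ^ α := by
  induction T with
  | zero => simp; linarith
  | succ T ih =>
    rw [Finset.sum_range_succ, mul_add]
    have hp : (0 : ℝ) < ((T + 1 + 1 : ℕ) : ℝ) := by positivity
    -- Bernoulli's inequality for `T + 1 = (T + 2) (1 - 1 / (T + 2))`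
    have hB := one_add_mul_self_le_rpow_one_add (s := -1 / ((T + 1 + 1 : ℕ) : ℝ)) (p := α + 1)
      (by rw [le_div_iff₀ hp]; push_cast; linarith [(Nat.cast_nonneg T : (0 : ℝ) ≤ T)])
      (by linarith)
    have e1 : 1 + -1 / ((T + 1 + 1 : ℕ) : ℝ) = ((T + 1 : ℕ) : ℝ) / ((T + 1 + 1 : ℕ) : ℝ) := by
      field_simp; push_cast; ring
    rw [e1, Real.div_rpow (by positivity) hp.le, Real.rpow_add_one (by positivity),
      Real.rpow_add_one hp.ne', le_div_iff₀ (by positivity)] at hB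
    have e2 : (1 + (α + 1) * (-1 / ((T + 1 + 1 : ℕ) : ℝ))) *
        (((T + 1 + 1 : ℕ) : ℝ) ^ α * ((T + 1 + 1 : ℕ) : ℝ)) =
        ((T + 1 + 1 : ℕ) : ℝ) ^ α * ((T + 1 + 1 : ℕ) : ℝ) -
          (α + 1) * ((T + 1 + 1 : ℕ) : ℝ) ^ α := by
      field_simp
      ring
    rw [e2] at hB
    push_cast at hB ih ⊢
    linarith

theorem monotone_weight {α : ℝ} (hα : 0 ≤ α) :
    Monotone fun t : ℕ => ((t + 1 : ℕ) : ℝ) ^ α := fun s t hst =>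
  Real.rpow_le_rpow (by positivity) (by exact_mod_cast Nat.succ_le_succ hst) hα

theorem sum_weight_pos (α : ℝ) (T : ℕ) :
    0 < ∑ t ∈ Finset.range (T + 1), ((t + 1 : ℕ) : ℝ) ^ α :=
  Finset.sum_pos (fun t _ => by positivity) ⟨0, by simp⟩

theorem sgdPIWA_mem {m n : ℕ} {α : ℝ} {h : Fin n → Vec m → ℝ} {idx : ℕ → Fin n} {η : ℝ}
    {C : Set (Vec m)} (hC : IsClosed C) (hconv : Convex ℝ C) {y : Vec m} (hy : y ∈ C) {T : ℕ} :
    sgdPIWA α h idx y η (T + 1) C ∈ C := by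
  have := hconv.centerMass_mem (t := Finset.range (T + 1))
    (w := fun t => ((t + 1 : ℕ) : ℝ) ^ α) (z := sgdIter h idx η C y)
    (fun t _ => by positivity) (sum_weight_pos α T) (fun t _ => sgdIter_mem hC hy t)
  exact this

/-- Jensen's inequality for the weighted average. -/
theorem sgdPIWA_map_le {m n : ℕ} {α : ℝ} {h : Fin n → Vec m → ℝ} {idx : ℕ → Fin n} {η : ℝ}
    {C : Set (Vec m)} (hC : IsClosed C) {y : Vec m} (hy : y ∈ C) {T : ℕ} {H : Vec m → ℝ}
    (hH : ConvexOn ℝ C H) (a : ℝ) :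
    H (sgdPIWA α h idx y η (T + 1) C) - a ≤
      (∑ t ∈ Finset.range (T + 1), ((t + 1 : ℕ) : ℝ) ^ α * (H (sgdIter h idx η C y t) - a)) /
        ∑ t ∈ Finset.range (T + 1), ((t + 1 : ℕ) : ℝ) ^ α := by
  have hW := sum_weight_pos α T
  have := hH.map_centerMass_le (t := Finset.range (T + 1))
    (w := fun t => ((t + 1 : ℕ) : ℝ) ^ α) (p := sgdIter h idx η C y)
    (fun t _ => by positivity) hW (fun t _ => sgdIter_mem hC hy t)
  simp only [Finset.centerMass, smul_eq_mul, Function.comp] at this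
  rw [le_div_iff₀ hW]
  simp only [mul_sub, Finset.sum_sub_distrib, ← Finset.sum_mul]
  rw [inv_mul_eq_div, le_div_iff₀ hW] at this
  unfold sgdPIWA
  linarith

/-! ### Sampling independent uniform indices -/

section Sampling

variable {ι W : Type*} {n : ℕ} [MeasurableSpace W] {P : Measure W} {Y : ι → W → Fin n}

theorem measurable_of_dependsOn (hY : ∀ p, Measurable (Y p)) {s : Set ι} (hs : s.Finite)
    {Q : (ι → Fin n) → ℝ} (hQ : DependsOn Q s) : Measurable fun ω => Q fun p => Y p ω := by
  obtain ⟨g, rfl⟩ := dependsOn_iff_exists_comp.1 hQ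
  have : Finite s := hs
  exact (measurable_of_finite g).comp (measurable_pi_lambda _ fun p => hY p)

theorem integral_indicator_index (hY : ∀ p, Measurable (Y p))
    (hunif : ∀ p i, P.real {ω | Y p ω = i} = 1 / (n : ℝ)) (p : ι) (i : Fin n) :
    ∫ ω, (if Y p ω = i then (1 : ℝ) else 0) ∂P = 1 / n := by
  have h := integral_indicator_one (μ := P) ((hY p) (measurableSet_singleton i))
  rw [← hunif p i]
  refine Eq.trans (integral_congr_ae (.of_forall fun ω => ?_)) h
  by_cases hω : Y p ω = i <;> simp [hω]

theorem integral_indicator_eq_measureReal (hY : ∀ p, Measurable (Y p)) {s : Set ι} (hs : s.Finite)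
    {A : Set (ι → Fin n)} (hA : DependsOn (A.indicator (1 : (ι → Fin n) → ℝ)) s) :
    ∫ ω, A.indicator 1 (fun q => Y q ω) ∂P = P.real {ω | (fun q => Y q ω) ∈ A} := by
  have e : {ω | (fun q => Y q ω) ∈ A} =
      (fun ω => A.indicator (1 : (ι → Fin n) → ℝ) fun q => Y q ω) ⁻¹' {1} := by
    ext ω
    by_cases hω : (fun q => Y q ω) ∈ A <;> simp [hω]
  have hm : MeasurableSet {ω | (fun q => Y q ω) ∈ A} := by
    rw [e]
    exact measurable_of_dependsOn hY hs hA (measurableSet_singleton 1)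
  rw [← integral_indicator_one hm]
  rfl

variable [IsProbabilityMeasure P]

theorem integrable_of_dependsOn (hY : ∀ p, Measurable (Y p)) {s : Set ι} (hs : s.Finite)
    {Q : (ι → Fin n) → ℝ} (hQ : DependsOn Q s) : Integrable (fun ω => Q fun p => Y p ω) P := by
  have hm := measurable_of_dependsOn hY hs hQ
  obtain ⟨g, rfl⟩ := dependsOn_iff_exists_comp.1 hQ
  have : Finite s := hs
  obtain ⟨M, hM⟩ := (Set.finite_range fun a => ‖g a‖).bddAbove
  exact Integrable.of_bound hm.aestronglyMeasurable M (.of_forall fun ω => hM ⟨_, rfl⟩)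

/-- Averaging out one index: an index that `Q` does not look at may be replaced, in expectation,
by the average over all its values. -/
theorem integral_eq_integral_avg (hY : ∀ p, Measurable (Y p)) (hindep : iIndepFun Y P)
    (hunif : ∀ p i, P.real {ω | Y p ω = i} = 1 / (n : ℝ)) {s : Set ι} (hs : s.Finite) {p : ι}
    (hp : p ∉ s) {Q : (ι → Fin n) → Fin n → ℝ} (hQ : ∀ i, DependsOn (fun J => Q J i) s) :
    ∫ ω, Q (fun q => Y q ω) (Y p ω) ∂P =
      ∫ ω, 1 / (n : ℝ) * ∑ i, Q (fun q => Y q ω) i ∂P := by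
  have hind : ∀ i, IndepFun (fun ω => if Y p ω = i then (1 : ℝ) else 0)
      (fun ω => Q (fun q => Y q ω) i) P := by
    intro i
    obtain ⟨g, hg⟩ := dependsOn_iff_exists_comp.1 (hQ i)
    lift s to Finset ι using hs
    have h := hindep.indepFun_finset {p} s (by simpa using hp) hY
    have h' := h.comp (φ := fun a => if a ⟨p, Finset.mem_singleton_self p⟩ = i then (1 : ℝ) else 0)
      (ψ := fun a => g a) (measurable_of_finite _) (measurable_of_finite _)
    have e : (fun ω => Q (fun q => Y q ω) i) = (fun a => g a) ∘ fun ω (q : s) => Y q ω :=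
      funext fun ω => congrFun hg fun q => Y q ω
    rw [e]
    exact h'
  have hint : ∀ i, Integrable
      (fun ω => (if Y p ω = i then (1 : ℝ) else 0) * Q (fun q => Y q ω) i) P := by
    intro i
    have hd : DependsOn (fun J : ι → Fin n => (if J p = i then (1 : ℝ) else 0) * Q J i)
        (insert p s) := by
      intro J J' h
      have h1 := hQ i fun q hq => h q (Set.mem_insert_of_mem p hq)
      simp only at h1 ⊢
      rw [h1, h p (Set.mem_insert p s)]
    exact integrable_of_dependsOn hY (hs.insert p) hd
  calc ∫ ω, Q (fun q => Y q ω) (Y p ω) ∂P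
      = ∫ ω, ∑ i, (if Y p ω = i then (1 : ℝ) else 0) * Q (fun q => Y q ω) i ∂P := by
        simp
    _ = ∑ i, (1 / (n : ℝ)) * ∫ ω, Q (fun q => Y q ω) i ∂P := by
        rw [integral_finsetSum _ fun i _ => hint i]
        refine Finset.sum_congr rfl fun i _ => ?_
        rw [← integral_indicator_index hY hunif p i]
        refine (hind i).integral_fun_mul_eq_mul_integral ?_ ?_
        · exact (measurable_of_finite fun j : Fin n => if j = i then (1 : ℝ) else 0).comp
            (hY p) |>.aestronglyMeasurable
        · exact (measurable_of_dependsOn hY hs (hQ i)).aestronglyMeasurable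
    _ = _ := by
        rw [integral_const_mul, integral_finsetSum _
          fun i _ => integrable_of_dependsOn hY hs (hQ i), Finset.mul_sum]

/-- Hoeffding's lemma for a function of one uniform index. -/
theorem avg_exp_le (hY : ∀ p, Measurable (Y p)) (hindep : iIndepFun Y P)
    (hunif : ∀ p i, P.real {ω | Y p ω = i} = 1 / (n : ℝ)) (p : ι) {a : Fin n → ℝ} {B c : ℝ}
    (hB : ∀ i, |a i - c| ≤ B) (hmean : ∑ i, a i = 0) :
    1 / (n : ℝ) * ∑ i, Real.exp (a i) ≤ Real.exp (B ^ 2 / 2) := by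
  have hm : Measurable fun ω => a (Y p ω) := (measurable_of_finite a).comp (hY p)
  have havg : ∀ b : Fin n → ℝ, ∫ ω, b (Y p ω) ∂P = 1 / (n : ℝ) * ∑ i, b i := fun b => by
    rw [integral_eq_integral_avg hY hindep hunif Set.finite_empty (p := p) (by simp)
      (Q := fun _ i => b i) fun i => dependsOn_const _]
    simp
  have hX := hasSubgaussianMGF_of_mem_Icc_of_integral_eq_zero (μ := P) hm.aemeasurable
    (a := c - B) (b := c + B)
    (.of_forall fun ω => by
      have := abs_le.1 (hB (Y p ω))
      exact ⟨by linarith [this.1], by linarith [this.2]⟩)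
    (by rw [havg, hmean, mul_zero])
  have h := hX.mgf_le 1
  simp only [mgf, one_mul] at h
  rw [havg fun i => Real.exp (a i)] at h
  refine h.trans_eq ?_
  congr 1
  have e : c + B - (c - B) = 2 * B := by ring
  push_cast
  rw [e, Real.norm_eq_abs, div_pow, sq_abs]
  ring

/-- An adaptive sum: its increment `ξ t` looks at the indices in `s t` and at one more index `p t`,
over which it has mean zero. -/
structure IsAdaptedNoise (s : ℕ → Set ι) (p : ℕ → ι) (ξ : ℕ → (ι → Fin n) → Fin n → ℝ) :
    Prop where
  finite : ∀ t, (s t).Finite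
  mono : ∀ t, s t ⊆ s (t + 1)
  notMem : ∀ t, p t ∉ s t
  mem : ∀ t, p t ∈ s (t + 1)
  dependsOn : ∀ t i, DependsOn (fun J => ξ t J i) (s t)
  sum_eq_zero : ∀ t J, ∑ i, ξ t J i = 0

variable {s : ℕ → Set ι} {p : ℕ → ι} {ξ : ℕ → (ι → Fin n) → Fin n → ℝ}

theorem IsAdaptedNoise.dependsOn_sum (h : IsAdaptedNoise s p ξ) (T : ℕ) :
    DependsOn (fun J => ∑ t ∈ Finset.range T, ξ t J (J (p t))) (s T) := by
  have hs : Monotone s := monotone_nat_of_le_succ h.mono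
  intro J J' hJ
  refine Finset.sum_congr rfl fun t ht => ?_
  have ht' : t + 1 ≤ T := Finset.mem_range.1 ht
  rw [hJ _ (hs ht' (h.mem t))]
  exact h.dependsOn t _ fun q hq => hJ q (hs (Nat.le_of_succ_le ht') hq)

theorem IsAdaptedNoise.integral_mul_sum_eq_zero (h : IsAdaptedNoise s p ξ)
    (hY : ∀ p, Measurable (Y p)) (hindep : iIndepFun Y P)
    (hunif : ∀ p i, P.real {ω | Y p ω = i} = 1 / (n : ℝ)) {A : (ι → Fin n) → ℝ}
    (hA : DependsOn A (s 0)) (T : ℕ) :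
    ∫ ω, A (fun q => Y q ω) * ∑ t ∈ Finset.range T, ξ t (fun q => Y q ω) (Y (p t) ω) ∂P = 0 := by
  have hs : Monotone s := monotone_nat_of_le_succ h.mono
  have hd : ∀ t i, DependsOn (fun J => A J * ξ t J i) (s t) := fun t i J J' hJ => by
    have h1 := h.dependsOn t i hJ
    simp only at h1 ⊢
    rw [h1, hA fun q hq => hJ q (hs t.zero_le hq)]
  have hd' : ∀ t, DependsOn (fun J : ι → Fin n => A J * ξ t J (J (p t))) (s (t + 1)) :=
    fun t J J' hJ => by
      have h1 := hd t (J' (p t)) fun q hq => hJ q (h.mono t hq)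
      simp only at h1 ⊢
      rw [hJ _ (h.mem t), h1]
  simp only [Finset.mul_sum]
  rw [integral_finsetSum _ fun t _ => integrable_of_dependsOn hY (h.finite (t + 1)) (hd' t)]
  refine Finset.sum_eq_zero fun t _ => ?_
  rw [integral_eq_integral_avg hY hindep hunif (h.finite t) (h.notMem t)
    (Q := fun J i => A J * ξ t J i) (hd t)]
  simp only [← Finset.mul_sum, h.sum_eq_zero, mul_zero, integral_zero]

/-- The exponential moment of an adaptive sum, by peeling off its last increment. -/
theorem IsAdaptedNoise.integral_mul_exp_le (h : IsAdaptedNoise s p ξ)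
    (hY : ∀ p, Measurable (Y p)) (hindep : iIndepFun Y P)
    (hunif : ∀ p i, P.real {ω | Y p ω = i} = 1 / (n : ℝ)) {A : (ι → Fin n) → ℝ}
    (hA : DependsOn A (s 0)) (hA0 : ∀ J, 0 ≤ A J) {B : ℕ → ℝ} {c : ℕ → (ι → Fin n) → ℝ}
    (hB : ∀ t J i, |ξ t J i - c t J| ≤ B t) (T : ℕ) :
    ∫ ω, A (fun q => Y q ω) *
        Real.exp (∑ t ∈ Finset.range T, ξ t (fun q => Y q ω) (Y (p t) ω)) ∂P ≤
      Real.exp (∑ t ∈ Finset.range T, B t ^ 2 / 2) * ∫ ω, A (fun q => Y q ω) ∂P := by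
  have hs : Monotone s := monotone_nat_of_le_succ h.mono
  induction T with
  | zero => simp
  | succ T ih =>
    have hE : DependsOn (fun J : ι → Fin n =>
        A J * Real.exp (∑ t ∈ Finset.range T, ξ t J (J (p t)))) (s T) := fun J J' hJ => by
      have h1 := h.dependsOn_sum T hJ
      simp only at h1 ⊢
      rw [h1, hA fun q hq => hJ q (hs T.zero_le hq)]
    have hd : ∀ i, DependsOn (fun J : ι → Fin n =>
        A J * Real.exp (∑ t ∈ Finset.range T, ξ t J (J (p t))) * Real.exp (ξ T J i)) (s T) :=
      fun i J J' hJ => by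
        have h1 := h.dependsOn T i hJ
        have h2 := hE hJ
        simp only at h1 h2 ⊢
        rw [h1, h2]
    have hsum : DependsOn (fun J : ι → Fin n => 1 / (n : ℝ) * ∑ i,
        A J * Real.exp (∑ t ∈ Finset.range T, ξ t J (J (p t))) * Real.exp (ξ T J i)) (s T) :=
      fun J J' hJ => by
        have : ∀ i, _ = _ := fun i => hd i hJ
        simp only at this ⊢
        simp only [this]
    simp only [Finset.sum_range_succ, Real.exp_add, ← mul_assoc]
    rw [integral_eq_integral_avg hY hindep hunif (h.finite T) (h.notMem T)
      (Q := fun J i => A J * Real.exp (∑ t ∈ Finset.range T, ξ t J (J (p t))) *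
        Real.exp (ξ T J i)) hd]
    calc _ ≤ ∫ ω, Real.exp (B T ^ 2 / 2) * (A (fun q => Y q ω) *
            Real.exp (∑ t ∈ Finset.range T, ξ t (fun q => Y q ω) (Y (p t) ω))) ∂P := by
          refine integral_mono (integrable_of_dependsOn hY (h.finite T) hsum)
            ((integrable_of_dependsOn hY (h.finite T) hE).const_mul _) fun ω => ?_
          have h1 := avg_exp_le hY hindep hunif (p T) (hB T fun q => Y q ω)
            (h.sum_eq_zero T fun q => Y q ω)
          have h2 := mul_le_mul_of_nonneg_left h1 (mul_nonneg (hA0 fun q => Y q ω)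
            (Real.exp_pos (∑ t ∈ Finset.range T, ξ t (fun q => Y q ω) (Y (p t) ω))).le)
          simp only [← Finset.mul_sum]
          linarith
      _ ≤ _ := by
          rw [integral_const_mul]
          have := mul_le_mul_of_nonneg_left ih (Real.exp_pos (B T ^ 2 / 2)).le
          linarith

/-- Markov's inequality on an event `A`. -/
theorem mul_measureReal_le_integral (hY : ∀ p, Measurable (Y p)) {s : Set ι} (hs : s.Finite)
    {A : Set (ι → Fin n)} (hA : DependsOn (A.indicator (1 : (ι → Fin n) → ℝ)) s)
    {Q : (ι → Fin n) → ℝ} (hQ : DependsOn Q s) (hQ0 : ∀ J ∈ A, 0 ≤ Q J) {b : ℝ} (hb : 0 < b) :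
    b * P.real {ω | (fun q => Y q ω) ∈ A ∧ b ≤ Q fun q => Y q ω} ≤
      ∫ ω, A.indicator 1 (fun q => Y q ω) * Q (fun q => Y q ω) ∂P := by
  have hd : DependsOn (fun J => A.indicator 1 J * Q J) s := fun J J' hJ => by
    simp only [hA hJ, hQ hJ]
  have h := mul_meas_ge_le_integral_of_nonneg (μ := P)
    (f := fun ω => A.indicator 1 (fun q => Y q ω) * Q (fun q => Y q ω))
    (.of_forall fun ω => by
      by_cases hω : (fun q => Y q ω) ∈ A <;> simp [hω]
      exact hQ0 _ hω)
    (integrable_of_dependsOn hY hs hd) b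
  refine Eq.trans_le ?_ h
  congr 2
  ext ω
  by_cases hω : (fun q => Y q ω) ∈ A <;> simp [hω, hb]

/-- Azuma-Hoeffding inequality for an adaptive sum, on an event `A` of the past. -/
theorem IsAdaptedNoise.measureReal_le_exp (h : IsAdaptedNoise s p ξ)
    (hY : ∀ p, Measurable (Y p)) (hindep : iIndepFun Y P)
    (hunif : ∀ p i, P.real {ω | Y p ω = i} = 1 / (n : ℝ)) {A : Set (ι → Fin n)}
    (hA : DependsOn (A.indicator (1 : (ι → Fin n) → ℝ)) (s 0)) {B : ℕ → ℝ}
    {c : ℕ → (ι → Fin n) → ℝ} (hB : ∀ t J i, |ξ t J i - c t J| ≤ B t) (T : ℕ) (b : ℝ) :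
    P.real {ω | (fun q => Y q ω) ∈ A ∧
        b ≤ ∑ t ∈ Finset.range T, ξ t (fun q => Y q ω) (Y (p t) ω)} ≤
      Real.exp (∑ t ∈ Finset.range T, B t ^ 2 / 2 - b) * P.real {ω | (fun q => Y q ω) ∈ A} := by
  have hs : Monotone s := monotone_nat_of_le_succ h.mono
  have hd : DependsOn (fun J : ι → Fin n =>
      Real.exp (∑ t ∈ Finset.range T, ξ t J (J (p t)))) (s T) := fun J J' hJ => by
    have h1 := h.dependsOn_sum T hJ
    simp only at h1 ⊢
    rw [h1]
  have h1 := mul_measureReal_le_integral (P := P) hY (h.finite T)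
    (hA.mono (hs T.zero_le)) hd (fun J _ => (Real.exp_pos _).le) (Real.exp_pos b)
  have h2 := h.integral_mul_exp_le hY hindep hunif hA
    (fun J => Set.indicator_nonneg (fun _ _ => zero_le_one) J) hB T
  rw [integral_indicator_eq_measureReal hY (h.finite 0) hA] at h2
  simp only [Real.exp_le_exp] at h1
  rw [Real.exp_sub, div_mul_eq_mul_div, le_div_iff₀ (Real.exp_pos b)]
  linarith

/-- Markov's inequality for an adaptive sum that is bounded below, on an event `A` of the past. -/
theorem IsAdaptedNoise.mul_measureReal_le (h : IsAdaptedNoise s p ξ)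
    (hY : ∀ p, Measurable (Y p)) (hindep : iIndepFun Y P)
    (hunif : ∀ p i, P.real {ω | Y p ω = i} = 1 / (n : ℝ)) {A : Set (ι → Fin n)}
    (hA : DependsOn (A.indicator (1 : (ι → Fin n) → ℝ)) (s 0)) (T : ℕ) {a b : ℝ} (hb : 0 < b)
    (hlow : ∀ J ∈ A, 0 ≤ a + ∑ t ∈ Finset.range T, ξ t J (J (p t))) :
    b * P.real {ω | (fun q => Y q ω) ∈ A ∧
        b ≤ a + ∑ t ∈ Finset.range T, ξ t (fun q => Y q ω) (Y (p t) ω)} ≤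
      a * P.real {ω | (fun q => Y q ω) ∈ A} := by
  have hs : Monotone s := monotone_nat_of_le_succ h.mono
  have hAT := hA.mono (hs T.zero_le)
  have hd : DependsOn (fun J : ι → Fin n => a + ∑ t ∈ Finset.range T, ξ t J (J (p t))) (s T) :=
    fun J J' hJ => by
      have h1 := h.dependsOn_sum T hJ
      simp only at h1 ⊢
      rw [h1]
  have hd' : DependsOn (fun J : ι → Fin n => A.indicator (1 : (ι → Fin n) → ℝ) J *
      ∑ t ∈ Finset.range T, ξ t J (J (p t))) (s T) := fun J J' hJ => by
    have h1 := h.dependsOn_sum T hJ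
    simp only at h1 ⊢
    rw [h1, hAT hJ]
  refine (mul_measureReal_le_integral (P := P) hY (h.finite T) hAT hd hlow hb).trans_eq ?_
  simp only [mul_add]
  rw [integral_add ((integrable_of_dependsOn hY (h.finite T) hAT).mul_const a)
    (integrable_of_dependsOn hY (h.finite T) hd'), h.integral_mul_sum_eq_zero hY hindep hunif hA,
    integral_mul_const, integral_indicator_eq_measureReal hY (h.finite 0) hA, add_zero, mul_comm]

end Sampling

/-! ### One stage of the algorithm: deterministic estimates -/

/-- The feasible set of the stage that starts at `y`: the points of `Ω` within distance `D`. -/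
def stageSet {m : ℕ} (Ω : Set (Vec m)) (D : ℝ) (y : Vec m) : Set (Vec m) :=
  {x | x ∈ Ω ∧ ‖x - y‖ ≤ D}

theorem stageSet_eq {m : ℕ} (Ω : Set (Vec m)) (D : ℝ) (y : Vec m) :
    stageSet Ω D y = Ω ∩ Metric.closedBall y D := by
  ext x
  simp [stageSet, dist_eq_norm]

theorem isCompact_stageSet {m : ℕ} {Ω : Set (Vec m)} (hΩ : IsClosed Ω) (D : ℝ) (y : Vec m) :
    IsCompact (stageSet Ω D y) := by
  rw [stageSet_eq]
  exact (isCompact_closedBall y D).inter_left hΩ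

theorem convex_stageSet {m : ℕ} {Ω : Set (Vec m)} (hΩ : Convex ℝ Ω) (D : ℝ) (y : Vec m) :
    Convex ℝ (stageSet Ω D y) := by
  rw [stageSet_eq]
  exact hΩ.inter (convex_closedBall y D)

theorem self_mem_stageSet {m : ℕ} {Ω : Set (Vec m)} {D : ℝ} (hD : 0 ≤ D) {y : Vec m}
    (hy : y ∈ Ω) : y ∈ stageSet Ω D y :=
  ⟨hy, by simpa using hD⟩

theorem norm_sub_le_of_mem_stageSet {m : ℕ} {Ω : Set (Vec m)} {D : ℝ} {y x u : Vec m}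
    (hx : x ∈ stageSet Ω D y) (hu : u ∈ stageSet Ω D y) : ‖x - u‖ ≤ 2 * D := by
  have e : x - u = (x - y) - (u - y) := by abel
  rw [e]
  linarith [norm_sub_le (x - y) (u - y), hx.2, hu.2]

/-- The minimum of the regularised objective over the feasible set of a stage is already below the
target `e` of that stage. The feasible set need not contain a minimizer of `F`: the distance of
`y` to the minimizers may be as large as `√2 * D`. -/
theorem stage_min_sub_le {m : ℕ} {Ω : Set (Vec m)} (hΩc : IsClosed Ω) (hΩ : Convex ℝ Ω)
    {F : Vec m → ℝ} (hF : ∀ x ∈ Ω, DifferentiableAt ℝ F x) {xs : Vec m}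
    (hmin : IsMinOn F Ω xs) {μ e D : ℝ} (hPL : PLOn μ Ω F xs) (hμ : 0 < μ) (he : 0 < e)
    (hD : D = √(2 * e / μ)) {y u : Vec m} (hy : y ∈ Ω) (hye : F y - F xs ≤ 2 * e)
    (hu : ∀ x ∈ stageSet Ω D y, F u + μ / 8 * ‖u - y‖ ^ 2 ≤ F x + μ / 8 * ‖x - y‖ ^ 2) :
    F u + μ / 8 * ‖u - y‖ ^ 2 - F xs ≤ 43 / 100 * e := by
  have hD0 : 0 ≤ D := hD ▸ Real.sqrt_nonneg _
  have hD2 : μ / 8 * D ^ 2 = e / 4 := by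
    rw [hD, Real.sq_sqrt (by positivity)]; field_simp; norm_num
  have hsμ := Real.sqrt_pos.2 hμ
  have hμ2 := Real.sq_sqrt hμ.le
  -- any rate below `√(μ / 2)` is allowed; `7 / 10` approximates `1 / √2` well enough
  obtain ⟨z, hz, hzD, hcase⟩ := exists_descent_of_PLOn hΩc hΩ hF hmin hPL
    (κ := 7 / 10 * √μ) (r := D) (by positivity) (by rw [mul_pow, hμ2]; linarith) hD0 hy
  have h1 := hu z ⟨hz, hzD⟩
  have h2 : μ / 8 * ‖z - y‖ ^ 2 ≤ e / 4 := by
    rw [← hD2]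
    have := pow_le_pow_left₀ (norm_nonneg _) hzD 2
    gcongr
  have h3 : F z - F xs ≤ 18 / 100 * e := by
    rcases hcase with h | h
    · rw [h]; linarith
    · have hκD : 7 / 10 * √μ * D = 7 / 10 * √(2 * e) := by
        rw [hD, mul_assoc, ← Real.sqrt_mul hμ.le]
        congr 2
        field_simp
      have h4 : √(F z - F xs) ≤ 3 / 10 * √(2 * e) := by
        have := Real.sqrt_le_sqrt hye
        linarith
      have h5 := pow_le_pow_left₀ (Real.sqrt_nonneg _) h4 2
      rw [Real.sq_sqrt (sub_nonneg.2 (hmin hz)), mul_pow, Real.sq_sqrt (by positivity)] at h5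
      linarith
  linarith

/-- The optimality gap of the output of a stage, with the noise of the stochastic gradients as the
last term. The regulariser cancels from the noise. -/
theorem stage_regret_le {m n : ℕ} {Z : Type*} {f : Z → Vec m → ℝ} {S : Fin n → Z}
    {Ω : Set (Vec m)} (hΩc : IsClosed Ω) (hΩ : Convex ℝ Ω) {G ρ b α η D Ghat : ℝ} (hn : 0 < n)
    (hG : ∀ x ∈ Ω, ∀ z, ‖∇ (f z) x‖ ^ 2 ≤ G ^ 2) (hweak : ∀ z, WeaklyConvexOn ρ Ω (f z))
    (hdiff : ∀ z, ∀ x ∈ Ω, DifferentiableAt ℝ (f z) x) (hb : ρ / 2 ≤ b) (hα : 0 ≤ α)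
    (hη : 0 < η) (hD : 0 ≤ D) (hGhat : 2 * G ^ 2 + 2 * (2 * b) ^ 2 * D ^ 2 ≤ Ghat ^ 2)
    {y u : Vec m} (hy : y ∈ Ω) (hu : u ∈ stageSet Ω D y) (idx : ℕ → Fin n) (T : ℕ)
    {h : Fin n → Vec m → ℝ} (hh : h = fun j x => f (S j) x + b * ‖x - y‖ ^ 2)
    {X : ℕ → Vec m} (hX : X = sgdIter h idx η (stageSet Ω D y) y) {xb : Vec m}
    (hxb : xb = sgdPIWA α h idx y η (T + 1) (stageSet Ω D y)) {w : ℕ → ℝ}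
    (hw : w = fun t : ℕ => ((t + 1 : ℕ) : ℝ) ^ α) :
    (empRisk f S xb + b * ‖xb - y‖ ^ 2) - (empRisk f S u + b * ‖u - y‖ ^ 2) ≤
      (α + 1) / ((T : ℝ) + 1) * (4 * D ^ 2) / (2 * η) + η * Ghat ^ 2 / 2 +
      ∑ t ∈ Finset.range (T + 1), w t / (∑ t ∈ Finset.range (T + 1), w t) *
        inner ℝ (∇ (empRisk f S) (X t) - ∇ (f (S (idx t))) (X t)) (X t - u) := by
  have hC := (isCompact_stageSet hΩc D y).isClosed
  have hconv := convex_stageSet hΩ D y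
  have hyC := self_mem_stageSet hD hy
  have hsub : stageSet Ω D y ⊆ Ω := fun x hx => hx.1
  have hgradh : ∀ i, ∀ x ∈ stageSet Ω D y, ∇ (h i) x = ∇ (f (S i)) x + (2 * b) • (x - y) := by
    intro i x hx
    rw [hh]
    exact (hasGradientAt_add_sq (hdiff (S i) x hx.1).hasGradientAt b y).gradient
  have hF : ∀ x ∈ Ω, DifferentiableAt ℝ (empRisk f S) x := fun x hx =>
    (hasGradientAt_empRisk fun z => hdiff z x hx).differentiableAt
  have hcv := convexOn_empRisk_add_sq (S := S) hn hweak hΩ hb y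
  have hcvC : ConvexOn ℝ (stageSet Ω D y) fun x => empRisk f S x + b * ‖x - y‖ ^ 2 :=
    hcv.subset hsub hconv
  have hJ := sgdPIWA_map_le (α := α) (h := h) (idx := idx) (η := η) hC hyC (T := T) hcvC
    (empRisk f S u + b * ‖u - y‖ ^ 2)
  have hreg := sum_regret_le (h := h) (idx := idx) hC hconv hyC hu hη (Γ := Ghat ^ 2)
    (A := 4 * D ^ 2)
    (fun i x hx => by
      rw [hgradh i x hx]
      have h1 := norm_add_le (∇ (f (S i)) x) ((2 * b) • (x - y))
      have h2 := hG x hx.1 (S i)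
      have h3 : ‖(2 * b) • (x - y)‖ ^ 2 ≤ (2 * b) ^ 2 * D ^ 2 := by
        rw [norm_smul, mul_pow, Real.norm_eq_abs, sq_abs]
        have := pow_le_pow_left₀ (norm_nonneg _) hx.2 2
        gcongr
      have h4 := pow_le_pow_left₀ (norm_nonneg _) h1 2
      nlinarith [sq_nonneg (‖∇ (f (S i)) x‖ - ‖(2 * b) • (x - y)‖)])
    (fun x hx => by
      have := pow_le_pow_left₀ (norm_nonneg _) (norm_sub_le_of_mem_stageSet hx hu) 2
      linarith)
    (H := fun x => empRisk f S x + b * ‖x - y‖ ^ 2)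
    (g := fun x => ∇ (empRisk f S) x + (2 * b) • (x - y))
    (fun x hx => sub_le_inner_of_convexOn hcv hx.1 hu.1
      (hasGradientAt_add_sq (hF x hx.1).hasGradientAt b y))
    (fun t => by positivity) (monotone_weight hα) T
  rw [← hxb] at hJ
  refine hJ.trans ?_
  have hW := sum_weight_pos α T
  have hw1 := mul_rpow_le_sum_rpow hα T
  rw [← hX] at hreg ⊢
  simp only [hw]
  rw [div_le_iff₀ hW]
  refine hreg.trans ?_
  set Wt := ∑ t ∈ Finset.range (T + 1), ((t + 1 : ℕ) : ℝ) ^ α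
  have h1 : ((T + 1 : ℕ) : ℝ) ^ α * (4 * D ^ 2) / (2 * η) ≤
      (α + 1) / ((T : ℝ) + 1) * (4 * D ^ 2) / (2 * η) * Wt := by
    have : ((T + 1 : ℕ) : ℝ) ^ α ≤ (α + 1) / ((T : ℝ) + 1) * Wt := by
      rw [div_mul_eq_mul_div, le_div_iff₀ (by positivity)]
      linarith
    calc _ ≤ (α + 1) / ((T : ℝ) + 1) * Wt * (4 * D ^ 2) / (2 * η) := by gcongr
      _ = _ := by ring
  have h2 : ∀ t, X t ∈ stageSet Ω D y := fun t => by rw [hX]; exact sgdIter_mem hC hyC t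
  rw [add_mul, add_mul, Finset.sum_mul]
  refine add_le_add (add_le_add h1 (le_of_eq (by ring))) (le_of_eq ?_)
  refine Finset.sum_congr rfl fun t _ => ?_
  rw [hgradh _ _ (h2 t), add_sub_add_right_eq_sub]
  field_simp

/-! ### Consequences of the choice of the parameters -/

/-- The deterministic part of the error of a stage. The first argument of the maximum `d` bounds the
distance term by `e / 4`; for `log (1 / δ) ≥ 1 / 10` the second one improves this when `c` is not
small, that is, when the step size term `c e / 4` is large. -/
theorem stage_error_le {α μ c e D η d N δ Ghat : ℝ} (hα : 0 ≤ α) (hμ : 0 < μ) (hc0 : 0 < c)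
    (hc1 : c ≤ 1) (he : 0 < e) (hGhat : 0 < Ghat) (hD : D ^ 2 = 2 * e / μ)
    (hη : η = e * c / (2 * Ghat ^ 2))
    (hd : d = max (32 * (α + 1) * Ghat ^ 2 / c)
      (512 * (α + 1) ^ 2 * Ghat ^ 2 * Real.log (1 / δ)))
    (hN0 : 0 < N) (hN : d / (μ * e) ≤ N) :
    (α + 1) / N * (4 * D ^ 2) / (2 * η) + η * Ghat ^ 2 / 2 ≤ e / 2 ∧
      (1 / 10 ≤ Real.log (1 / δ) →
        (α + 1) / N * (4 * D ^ 2) / (2 * η) + η * Ghat ^ 2 / 2 ≤ 13 / 32 * e) := by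
  have h1 : (α + 1) / N * (4 * D ^ 2) / (2 * η) = 8 * (α + 1) * Ghat ^ 2 / (μ * c * N) := by
    rw [hD, hη]; field_simp; ring
  have h2 : η * Ghat ^ 2 / 2 = c * e / 4 := by rw [hη]; field_simp; ring
  rw [div_le_iff₀ (by positivity)] at hN
  have h3 := (hd ▸ le_max_left _ _ : 32 * (α + 1) * Ghat ^ 2 / c ≤ d).trans hN
  have h4 := (hd ▸ le_max_right _ _ :
    512 * (α + 1) ^ 2 * Ghat ^ 2 * Real.log (1 / δ) ≤ d).trans hN
  rw [div_le_iff₀ hc0] at h3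
  have h5 : 8 * (α + 1) * Ghat ^ 2 / (μ * c * N) ≤ e / 4 := by
    rw [div_le_iff₀ (by positivity)]; linarith
  rw [h1, h2]
  refine ⟨by nlinarith, fun hδ => ?_⟩
  rcases le_or_gt c (5 / 8) with hc | hc
  · nlinarith
  · have h6 : 512 / 10 * (α + 1) * Ghat ^ 2 ≤ N * (μ * e) := by
      have h7 : 512 * (α + 1) ^ 2 * Ghat ^ 2 * (1 / 10) ≤
          512 * (α + 1) ^ 2 * Ghat ^ 2 * Real.log (1 / δ) := by gcongr
      have h8 : (α + 1) * Ghat ^ 2 ≤ (α + 1) ^ 2 * Ghat ^ 2 := by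
        have : α + 1 ≤ (α + 1) ^ 2 := by nlinarith
        gcongr
      linarith
    have h9 : 8 * (α + 1) * Ghat ^ 2 / (μ * c * N) ≤ 5 / 32 * (e / c) := by
      rw [div_le_iff₀ (by positivity)]
      have : 5 / 32 * (e / c) * (μ * c * N) = 5 / 32 * (N * (μ * e)) := by field_simp
      rw [this]; linarith
    -- `5 / (32 c) + c / 4` is convex in `c` and equals `13 / 32` at both `5 / 8` and `1`
    have h10 : 5 / 32 * (e / c) ≤ (13 / 32 - c / 4) * e := by
      rw [← mul_div_assoc, div_le_iff₀ hc0]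
      have h11 : 0 ≤ (1 - c) * (c - 5 / 8) * e :=
        mul_nonneg (mul_nonneg (by linarith) (by linarith)) he.le
      nlinarith
    linarith

/-- The exponent of the Azuma-Hoeffding bound for the noise scaled by `16 * log (1 / δ) / e`. -/
theorem stage_variance_le {α μ e D d δ G Ghat lam : ℝ} (hα : 0 ≤ α) (hμ : 0 < μ) (he : 0 < e)
    (hG : 2 * G ^ 2 ≤ Ghat ^ 2) (hD : D ^ 2 = 2 * e / μ) (hδ : 0 < Real.log (1 / δ))
    (hd : 512 * (α + 1) ^ 2 * Ghat ^ 2 * Real.log (1 / δ) ≤ d) (T : ℕ)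
    (hN : d / (μ * e) ≤ (T : ℝ) + 1) (hlam : lam = 16 * Real.log (1 / δ) / e) {w : ℕ → ℝ}
    (hw : w = fun t : ℕ => ((t + 1 : ℕ) : ℝ) ^ α) :
    ∑ t ∈ Finset.range (T + 1),
      (lam * (w t / (∑ t ∈ Finset.range (T + 1), w t) * (|G| * (2 * D)))) ^ 2 / 2 ≤
        Real.log (1 / δ) := by
  have hwt : ∀ t, 0 < w t := fun t => by rw [hw]; positivity
  have hmono : Monotone w := hw ▸ monotone_weight hα
  have hW : 0 < ∑ t ∈ Finset.range (T + 1), w t := hw ▸ sum_weight_pos α T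
  have hlast : ((T : ℝ) + 1) * w T ≤ (α + 1) * ∑ t ∈ Finset.range (T + 1), w t :=
    hw ▸ mul_rpow_le_sum_rpow hα T
  set Wt := ∑ t ∈ Finset.range (T + 1), w t with hWt
  set ℓ := Real.log (1 / δ)
  have hsq : ∑ t ∈ Finset.range (T + 1), w t ^ 2 ≤ w T * Wt := by
    rw [hWt, Finset.mul_sum]
    refine Finset.sum_le_sum fun t ht => ?_
    have := hmono (Nat.lt_succ_iff.1 (Finset.mem_range.1 ht))
    nlinarith [hwt t]
  have e1 : ∑ t ∈ Finset.range (T + 1), (lam * (w t / Wt * (|G| * (2 * D)))) ^ 2 / 2 =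
      lam ^ 2 * (2 * G ^ 2) * D ^ 2 / Wt ^ 2 * ∑ t ∈ Finset.range (T + 1), w t ^ 2 := by
    rw [Finset.mul_sum]
    refine Finset.sum_congr rfl fun t _ => ?_
    simp only [mul_pow, div_pow, sq_abs]
    ring
  rw [e1]
  rw [div_le_iff₀ (by positivity)] at hN
  have h1 : w T * Wt ≤ (α + 1) / ((T : ℝ) + 1) * Wt ^ 2 := by
    rw [div_mul_eq_mul_div, le_div_iff₀ (by positivity)]
    nlinarith
  calc lam ^ 2 * (2 * G ^ 2) * D ^ 2 / Wt ^ 2 * ∑ t ∈ Finset.range (T + 1), w t ^ 2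
      ≤ lam ^ 2 * Ghat ^ 2 * D ^ 2 / Wt ^ 2 * ((α + 1) / ((T : ℝ) + 1) * Wt ^ 2) := by
        have := hsq.trans h1
        gcongr
    _ = 512 * (α + 1) * Ghat ^ 2 * ℓ ^ 2 / (μ * e * ((T : ℝ) + 1)) := by
        rw [hD, hlam]; field_simp; ring
    _ ≤ ℓ := by
        rw [div_le_iff₀ (by positivity)]
        have h2 : (α + 1) * Ghat ^ 2 * ℓ ≤ (α + 1) ^ 2 * Ghat ^ 2 * ℓ := by
          have : α + 1 ≤ (α + 1) ^ 2 := by nlinarith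
          gcongr
        have h3 : 512 * (α + 1) * Ghat ^ 2 * ℓ ≤ μ * e * ((T : ℝ) + 1) := by linarith
        nlinarith

/-! ### One stage of the algorithm: the probability of failure -/

/-- Given that a stage starts at a point with optimality gap at most `2 e`, the conditional
probability that its output has a gap larger than `e` is at most `δ`. When `log (1 / δ) ≥ 1 / 10`
the noise is bounded by the Azuma-Hoeffding inequality. For larger `δ` that bound is too weak, but then the
nonnegative gap to the minimum of the regularised objective has a small enough expectation for
Markov's inequality. -/
theorem stage_failure_le {m n : ℕ} {Z : Type*} {f : Z → Vec m → ℝ} {S : Fin n → Z}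
    {Ω : Set (Vec m)} {xs : Vec m} (hΩc : IsClosed Ω) (hΩ : Convex ℝ Ω)
    (hmin : IsMinOn (empRisk f S) Ω xs) {G ρ μ α δ c d b e η D Ghat : ℝ} (hn : 0 < n)
    (hμ : 0 < μ) (hG : ∀ x ∈ Ω, ∀ z, ‖∇ (f z) x‖ ^ 2 ≤ G ^ 2)
    (hweak : ∀ z, WeaklyConvexOn ρ Ω (f z)) (hdiff : ∀ z, ∀ x ∈ Ω, DifferentiableAt ℝ (f z) x)
    (hPL : PLOn μ Ω (empRisk f S) xs) (hρμ : ρ ≤ μ / 4) (hb : b = μ / 8) (hα : 0 ≤ α)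
    (hδ0 : 0 < δ) (hc0 : 0 < c) (hc1 : c ≤ 1) (he : 0 < e)
    (hD : D = √(2 * e / μ)) (hGhat0 : 0 < Ghat)
    (hGhat : 2 * G ^ 2 + 2 * (2 * b) ^ 2 * D ^ 2 ≤ Ghat ^ 2)
    (hη : η = e * c / (2 * Ghat ^ 2))
    (hd : d = max (32 * (α + 1) * Ghat ^ 2 / c)
      (512 * (α + 1) ^ 2 * Ghat ^ 2 * Real.log (1 / δ)))
    {T : ℕ} (hT : d / (μ * e) ≤ (T : ℝ) + 1)
    {W ι : Type*} [MeasurableSpace W] {P : Measure W} [IsProbabilityMeasure P]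
    {Y : ι → W → Fin n} (hY : ∀ p, Measurable (Y p)) (hindep : iIndepFun Y P)
    (hunif : ∀ p i, P.real {ω | Y p ω = i} = 1 / (n : ℝ))
    {y : (ι → Fin n) → Vec m} {s : Set ι} (hs : s.Finite) (hy : DependsOn y s)
    (hyΩ : ∀ J, y J ∈ Ω) {p : ℕ → ι} (hp : Function.Injective p) (hps : ∀ t, p t ∉ s)
    {out : (ι → Fin n) → Vec m}
    (hout : out = fun J => sgdPIWA α (fun j x => f (S j) x + b * ‖x - y J‖ ^ 2)
      (fun t => J (p t)) (y J) η (T + 1) (stageSet Ω D (y J))) :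
    P.real {ω | empRisk f S (y fun q => Y q ω) - empRisk f S xs ≤ 2 * e ∧
        e < empRisk f S (out fun q => Y q ω) - empRisk f S xs} ≤
      δ * P.real {ω | empRisk f S (y fun q => Y q ω) - empRisk f S xs ≤ 2 * e} := by
  have hD0 : 0 ≤ D := hD ▸ Real.sqrt_nonneg _
  have hD2 : D ^ 2 = 2 * e / μ := by rw [hD, Real.sq_sqrt (by positivity)]
  have hη0 : 0 < η := by rw [hη]; positivity
  have hρb : ρ / 2 ≤ b := by rw [hb]; linarith
  have hF : ∀ x ∈ Ω, DifferentiableAt ℝ (empRisk f S) x := fun x hx =>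
    (hasGradientAt_empRisk fun z => hdiff z x hx).differentiableAt
  have hFgrad : ∀ x ∈ Ω, ∇ (empRisk f S) x = (1 / (n : ℝ)) • ∑ i, ∇ (f (S i)) x := fun x hx =>
    (hasGradientAt_empRisk fun z => hdiff z x hx).gradient
  have hexists : ∀ a : Ω, ∃ u ∈ stageSet Ω D (a : Vec m), ∀ x ∈ stageSet Ω D (a : Vec m),
      empRisk f S u + b * ‖u - a‖ ^ 2 ≤ empRisk f S x + b * ‖x - a‖ ^ 2 := by
    intro a
    have hcont : ContinuousOn (fun x => empRisk f S x + b * ‖x - a‖ ^ 2)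
        (stageSet Ω D (a : Vec m)) := by
      have : ContinuousOn (empRisk f S) (stageSet Ω D (a : Vec m)) := fun z hz =>
        (hF z hz.1).continuousAt.continuousWithinAt
      exact this.add (by fun_prop)
    obtain ⟨u, hu, hmin⟩ := (isCompact_stageSet hΩc D (a : Vec m)).exists_isMinOn
      ⟨a, self_mem_stageSet hD0 a.2⟩ hcont
    exact ⟨u, hu, fun x hx => hmin hx⟩
  choose u₀ hu₀ hu₀min using hexists
  set u : (ι → Fin n) → Vec m := fun J => u₀ ⟨y J, hyΩ J⟩ with hu
  have huC : ∀ J, u J ∈ stageSet Ω D (y J) := fun J => hu₀ ⟨y J, hyΩ J⟩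
  have humin : ∀ J, ∀ x ∈ stageSet Ω D (y J),
      empRisk f S (u J) + b * ‖u J - y J‖ ^ 2 ≤ empRisk f S x + b * ‖x - y J‖ ^ 2 :=
    fun J => hu₀min ⟨y J, hyΩ J⟩
  have hudep : DependsOn u s := fun J J' hJ => by
    have h := hy hJ
    simp only [hu, h]
  set h : (ι → Fin n) → Fin n → Vec m → ℝ :=
    fun J j x => f (S j) x + b * ‖x - y J‖ ^ 2 with hh
  set X : (ι → Fin n) → ℕ → Vec m := fun J =>
    sgdIter (h J) (fun t => J (p t)) η (stageSet Ω D (y J)) (y J) with hX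
  have hXC : ∀ J t, X J t ∈ stageSet Ω D (y J) := fun J t =>
    sgdIter_mem (isCompact_stageSet hΩc D (y J)).isClosed (self_mem_stageSet hD0 (hyΩ J)) t
  have hXdep : ∀ t, DependsOn (fun J => X J t) (s ∪ p '' Set.Iio t) := fun t J J' hJ => by
    have h1 := hy fun q hq => hJ q (Or.inl hq)
    simp only [hX, hh, h1]
    exact sgdIter_congr fun t' ht' => hJ _ (Or.inr ⟨t', ht', rfl⟩)
  set w : ℕ → ℝ := fun t : ℕ => ((t + 1 : ℕ) : ℝ) ^ α with hw
  set Wt := ∑ t ∈ Finset.range (T + 1), w t with hWt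
  have hWt0 : 0 < Wt := sum_weight_pos α T
  have hwt : ∀ t, 0 < w t := fun t => by positivity
  set ξ : ℝ → ℕ → (ι → Fin n) → Fin n → ℝ := fun lam t J i => lam * (w t / Wt *
    inner ℝ (∇ (empRisk f S) (X J t) - ∇ (f (S i)) (X J t)) (X J t - u J)) with hξ
  have hnoise : ∀ lam, IsAdaptedNoise (fun t => s ∪ p '' Set.Iio t) p (ξ lam) := fun lam =>
    { finite := fun t => hs.union ((Set.finite_Iio t).image p)
      mono := fun t => Set.union_subset_union_right _
        (Set.image_mono (Set.Iio_subset_Iio t.le_succ))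
      notMem := by
        rintro t (h1 | ⟨t', ht', h1⟩)
        · exact hps t h1
        · exact (ne_of_lt (Set.mem_Iio.1 ht')) (hp h1)
      mem := fun t => Or.inr ⟨t, Set.mem_Iio.2 t.lt_succ_self, rfl⟩
      dependsOn := fun t i J J' hJ => by
        have h1 := hXdep t hJ
        have h2 := hudep fun q hq => hJ q (Or.inl hq)
        simp only at h1
        simp only [hξ, h1, h2]
      sum_eq_zero := fun t J => by
        have hn' : (n : ℝ) ≠ 0 := by positivity
        simp only [hξ, ← Finset.mul_sum, ← sum_inner, Finset.sum_sub_distrib, Finset.sum_const,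
          Finset.card_univ, Fintype.card_fin]
        rw [hFgrad _ (hXC J t).1, ← Nat.cast_smul_eq_nsmul ℝ, smul_smul,
          mul_one_div_cancel hn', one_smul, sub_self, inner_zero_left, mul_zero, mul_zero] }
  set A : Set (ι → Fin n) := {J | empRisk f S (y J) - empRisk f S xs ≤ 2 * e} with hA
  have hAdep : DependsOn (A.indicator (1 : (ι → Fin n) → ℝ)) (s ∪ p '' Set.Iio 0) :=
    fun J J' hJ => by
      have h1 := hy fun q hq => hJ q (Or.inl hq)
      simp only [Set.indicator_apply, hA, Set.mem_ofPred_eq, h1, Pi.one_apply]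
  have hregret : ∀ J, (empRisk f S (out J) + b * ‖out J - y J‖ ^ 2) -
      (empRisk f S (u J) + b * ‖u J - y J‖ ^ 2) ≤
      (α + 1) / ((T : ℝ) + 1) * (4 * D ^ 2) / (2 * η) + η * Ghat ^ 2 / 2 +
        ∑ t ∈ Finset.range (T + 1), ξ 1 t J (J (p t)) := by
    intro J
    simp only [hξ, one_mul]
    exact stage_regret_le hΩc hΩ hn hG hweak hdiff hρb hα hη0 hD0 hGhat (hyΩ J) (huC J)
      (fun t => J (p t)) T rfl rfl (by rw [hout]) rfl
  have hcmp : ∀ J ∈ A,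
      empRisk f S (u J) + b * ‖u J - y J‖ ^ 2 - empRisk f S xs ≤ 43 / 100 * e := by
    intro J hJ
    have := humin J
    rw [hb] at this ⊢
    exact stage_min_sub_le hΩc hΩ hF hmin hPL hμ he hD (hyΩ J) hJ this
  have houtC : ∀ J, out J ∈ stageSet Ω D (y J) := fun J => by
    rw [hout]
    exact sgdPIWA_mem (isCompact_stageSet hΩc D (y J)).isClosed (convex_stageSet hΩ D (y J))
      (self_mem_stageSet hD0 (hyΩ J))
  have hb0 : 0 ≤ b := by rw [hb]; positivity
  obtain ⟨herr, herr'⟩ := stage_error_le hα hμ hc0 hc1 he hGhat0 hD2 hη hd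
    (by positivity : (0 : ℝ) < (T : ℝ) + 1) hT
  have hPA : 0 ≤ P.real {ω | (fun q => Y q ω) ∈ A} := measureReal_nonneg
  change P.real {ω | (fun q => Y q ω) ∈ A ∧ _} ≤ δ * P.real {ω | (fun q => Y q ω) ∈ A}
  rcases le_or_gt (1 / 10) (Real.log (1 / δ)) with hlog | hlog
  · -- Azuma-Hoeffding for the noise scaled by `lam`
    set lam := 16 * Real.log (1 / δ) / e with hlam
    have hlog0 : 0 < Real.log (1 / δ) := by linarith
    have hlam0 : 0 < lam := by positivity
    have hB : ∀ t J i, |ξ lam t J i - lam * (w t / Wt *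
        inner ℝ (∇ (empRisk f S) (X J t)) (X J t - u J))| ≤
        lam * (w t / Wt * (|G| * (2 * D))) := by
      intro t J i
      have e1 : ξ lam t J i - lam * (w t / Wt *
          inner ℝ (∇ (empRisk f S) (X J t)) (X J t - u J)) =
          - (lam * (w t / Wt * inner ℝ (∇ (f (S i)) (X J t)) (X J t - u J))) := by
        simp only [hξ, inner_sub_left]
        ring
      have h1 : ‖∇ (f (S i)) (X J t)‖ ≤ |G| := by
        have := sq_le_sq.1 (hG _ (hXC J t).1 (S i))
        rwa [abs_of_nonneg (norm_nonneg _)] at this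
      have hwW : 0 ≤ w t / Wt := by have := hwt t; positivity
      rw [e1, abs_neg, abs_mul, abs_mul, abs_of_pos hlam0, abs_of_nonneg hwW]
      refine mul_le_mul_of_nonneg_left (mul_le_mul_of_nonneg_left ?_ hwW) hlam0.le
      exact (abs_real_inner_le_norm _ _).trans (mul_le_mul h1
        (norm_sub_le_of_mem_stageSet (hXC J t) (huC J)) (norm_nonneg _) (abs_nonneg _))
    have hvar := stage_variance_le hα hμ he (by nlinarith [sq_nonneg (2 * b * D)]) hD2 hlog0
      (hd ▸ le_max_right _ _) T hT hlam hw (G := G)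
    have htail := (hnoise lam).measureReal_le_exp (P := P) hY hindep hunif hAdep hB (T + 1)
      (2 * Real.log (1 / δ))
    have hexp : Real.exp (∑ t ∈ Finset.range (T + 1),
        (lam * (w t / Wt * (|G| * (2 * D)))) ^ 2 / 2 - 2 * Real.log (1 / δ)) ≤ δ := by
      calc _ ≤ Real.exp (-Real.log (1 / δ)) := Real.exp_le_exp.2 (by linarith)
        _ = δ := by rw [one_div, Real.log_inv, neg_neg, Real.exp_log hδ0]
    refine le_trans (measureReal_mono ?_) (htail.trans (mul_le_mul_of_nonneg_right hexp hPA))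
    rintro ω ⟨hωA, hω⟩
    refine ⟨hωA, ?_⟩
    have h1 := hregret fun q => Y q ω
    have h2 := hcmp _ hωA
    have h3 := herr' hlog
    have h4 : 0 ≤ b * ‖(out fun q => Y q ω) - y fun q => Y q ω‖ ^ 2 := by positivity
    have h5 : e / 8 ≤ ∑ t ∈ Finset.range (T + 1), ξ 1 t (fun q => Y q ω) (Y (p t) ω) := by
      linarith
    have h6 : ∑ t ∈ Finset.range (T + 1), ξ lam t (fun q => Y q ω) (Y (p t) ω) =
        lam * ∑ t ∈ Finset.range (T + 1), ξ 1 t (fun q => Y q ω) (Y (p t) ω) := by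
      simp only [hξ, one_mul, ← Finset.mul_sum]
    have h7 : 2 * Real.log (1 / δ) = lam * (e / 8) := by rw [hlam]; field_simp; norm_num
    rw [h6, h7]
    exact mul_le_mul_of_nonneg_left h5 hlam0.le
  · -- Markov for the gap to the minimum of the regularised objective
    have hδ9 : 9 / 10 ≤ δ := by
      have := Real.one_sub_inv_le_log_of_pos (by positivity : 0 < 1 / δ)
      rw [one_div, inv_inv, ← one_div] at this
      linarith
    have htail := (hnoise 1).mul_measureReal_le (P := P) hY hindep hunif hAdep (T + 1)
      (a := e / 2) (b := 57 / 100 * e) (by positivity) fun J _ => by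
        have h1 := hregret J
        have h2 := humin J _ (houtC J)
        linarith
    have hfail : P.real {ω | (fun q => Y q ω) ∈ A ∧
        e < empRisk f S (out fun q => Y q ω) - empRisk f S xs} ≤
        P.real {ω | (fun q => Y q ω) ∈ A ∧ 57 / 100 * e ≤
          e / 2 + ∑ t ∈ Finset.range (T + 1), ξ 1 t (fun q => Y q ω) (Y (p t) ω)} := by
      refine measureReal_mono ?_
      rintro ω ⟨hωA, hω⟩
      refine ⟨hωA, ?_⟩
      have h1 := hregret fun q => Y q ω
      have h2 := hcmp _ hωA
      have h4 : 0 ≤ b * ‖(out fun q => Y q ω) - y fun q => Y q ω‖ ^ 2 := by positivity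
      linarith
    have h8 : 57 / 100 * P.real {ω | (fun q => Y q ω) ∈ A ∧ 57 / 100 * e ≤
          e / 2 + ∑ t ∈ Finset.range (T + 1), ξ 1 t (fun q => Y q ω) (Y (p t) ω)} ≤
        1 / 2 * P.real {ω | (fun q => Y q ω) ∈ A} := by
      refine le_of_mul_le_mul_left ?_ he
      linarith
    nlinarith

/-! ### The stagewise algorithm -/

theorem stagewise_mem {m n : ℕ} {Z : Type*} {f : Z → Vec m → ℝ} {S : Fin n → Z}
    {Ω : Set (Vec m)} (hΩc : IsClosed Ω) (hΩ : Convex ℝ Ω) {α γ : ℝ} {η D : ℕ → ℝ} {T : ℕ → ℕ}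
    (hD : ∀ k, 0 ≤ D (k + 1)) (hT : ∀ k, 0 < T k) {x0 : Vec m} (hx0 : x0 ∈ Ω)
    (idx : ℕ → ℕ → Fin n) (k : ℕ) : stagewise f S Ω α γ η D T x0 idx k ∈ Ω := by
  induction k with
  | zero => exact hx0
  | succ k ih =>
    obtain ⟨T', hT'⟩ := Nat.exists_eq_add_of_lt (hT (k + 1))
    rw [zero_add] at hT'
    simp only [stagewise, hT']
    exact (sgdPIWA_mem (isCompact_stageSet hΩc (D (k + 1)) _).isClosed
      (convex_stageSet hΩ (D (k + 1)) _) (self_mem_stageSet (hD k) ih)).1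

theorem dependsOn_stagewise {m n : ℕ} {Z : Type*} (f : Z → Vec m → ℝ) (S : Fin n → Z)
    (Ω : Set (Vec m)) (α γ : ℝ) (η D : ℕ → ℝ) (T : ℕ → ℕ) (x0 : Vec m) (k : ℕ) :
    DependsOn (fun J : ℕ × ℕ → Fin n =>
      stagewise f S Ω α γ η D T x0 (fun k t => J (k, t)) k)
      {q | q.1 ≤ k ∧ q.2 < T q.1} := by
  induction k with
  | zero => exact fun _ _ _ => rfl
  | succ k ih =>
    intro J J' hJ
    have h1 := ih fun q hq => hJ q ⟨hq.1.trans k.le_succ, hq.2⟩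
    simp only at h1
    simp only [stagewise, h1]
    exact sgdPIWA_congr fun t ht => hJ (k + 1, t) ⟨le_rfl, ht⟩

theorem finite_index_set (T : ℕ → ℕ) (k : ℕ) :
    {q : ℕ × ℕ | q.1 ≤ k ∧ q.2 < T q.1}.Finite := by
  refine (((Finset.range (k + 1)).sigma fun k => Finset.range (T k)).finite_toSet.image
    fun q => (q.1, q.2)).subset ?_
  rintro ⟨i, t⟩ ⟨h1, h2⟩
  exact ⟨⟨i, t⟩, by simpa using ⟨h1, h2⟩, rfl⟩

/-- The total number of iterations: a geometric sum, whose last term is controlled by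
`2 ^ (K - 1) < ε₀ / ε`, plus the `K` roundings. -/
theorem sum_iterations_le {μ ε₀ ε d : ℝ} (hμ : 0 < μ) (hε₀ : 0 < ε₀) (hε : 0 < ε)
    (hd : 4 * μ * ε₀ ≤ d) {T : ℕ → ℕ} (hT : ∀ k, T k = ⌈d / (μ * (ε₀ / 2 ^ k))⌉₊) {K : ℕ}
    (hK : K = ⌈Real.logb 2 (ε₀ / ε)⌉₊) :
    ∑ k ∈ Finset.Icc 1 K, (T k : ℝ) ≤ 5 * d / (μ * ε) := by
  have hd0 : 0 < d := lt_of_lt_of_le (by positivity) hd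
  rcases Nat.eq_zero_or_pos K with h0 | hpos
  · rw [h0]
    simp
    positivity
  have hKlt : ((K : ℕ) : ℝ) < Real.logb 2 (ε₀ / ε) + 1 := by
    rw [hK]
    refine Nat.ceil_lt_add_one (le_of_lt ?_)
    by_contra hneg
    rw [Nat.ceil_eq_zero.2 (not_lt.1 hneg)] at hK
    omega
  have hpow : (2 : ℝ) ^ K ≤ 2 * (ε₀ / ε) := by
    have h1 : (2 : ℝ) ^ (K : ℝ) ≤ 2 ^ (Real.logb 2 (ε₀ / ε) + 1) :=
      Real.rpow_le_rpow_of_exponent_le one_le_two hKlt.le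
    rw [Real.rpow_add two_pos, Real.rpow_logb two_pos (by norm_num) (by positivity),
      Real.rpow_natCast, Real.rpow_one] at h1
    linarith
  have hgeom : ∀ K : ℕ, ∑ k ∈ Finset.Icc 1 K, (T k : ℝ) ≤ d / (μ * ε₀) * (2 * 2 ^ K) + K := by
    intro K
    induction K with
    | zero => simp; positivity
    | succ K ih =>
      rw [Finset.sum_Icc_succ_top (by omega)]
      have h1 : (T (K + 1) : ℝ) ≤ d / (μ * (ε₀ / 2 ^ (K + 1))) + 1 := by
        rw [hT]
        exact (Nat.ceil_lt_add_one (by positivity)).le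
      have h2 : d / (μ * (ε₀ / 2 ^ (K + 1))) = d / (μ * ε₀) * (2 * 2 ^ K) := by
        rw [pow_succ]
        field_simp
      push_cast
      rw [pow_succ (2 : ℝ)]
      linarith
  have h1 : d / (μ * ε₀) * (2 * 2 ^ K) ≤ 4 * d / (μ * ε) := by
    calc _ ≤ d / (μ * ε₀) * (2 * (2 * (ε₀ / ε))) := by gcongr
      _ = _ := by field_simp; norm_num
  have h2 : (K : ℝ) ≤ d / (μ * ε) := by
    have h3 : (K : ℝ) < 2 ^ K := by exact_mod_cast K.lt_two_pow_self
    calc (K : ℝ) ≤ 2 * (ε₀ / ε) := h3.le.trans hpow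
      _ = 2 * μ * ε₀ / (μ * ε) := by field_simp
      _ ≤ d / (μ * ε) := by
        gcongr
        nlinarith [mul_pos hμ hε₀]
  have h4 : 5 * d / (μ * ε) = 4 * d / (μ * ε) + d / (μ * ε) := by ring
  linarith [hgeom K]

end PIWA

theorem theorem5 {m n : ℕ} {Z : Type*}
    -- the problem
    (f : Z → PIWA.Vec m → ℝ) (S : Fin n → Z) (Ω : Set (PIWA.Vec m)) (xs x0 : PIWA.Vec m)
    (hΩc : IsClosed Ω) (hΩ : Convex ℝ Ω)
    (hxs : xs ∈ Ω) (hmin : IsMinOn (PIWA.empRisk f S) Ω xs) (hx0 : x0 ∈ Ω)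
    -- the assumptions on the losses and on the empirical risk
    (G L ρ μ ε₀ : ℝ) (hL : 0 < L) (hρ : 0 < ρ) (hμ : 0 < μ) (hε₀ : 0 < ε₀)
    (hG : ∀ x ∈ Ω, ∀ z, ‖∇ (f z) x‖ ^ 2 ≤ G ^ 2)
    (hweak : ∀ z, PIWA.WeaklyConvexOn ρ Ω (f z))
    (hsmooth : ∀ z, PIWA.SmoothOn L Ω (f z))
    (hinit : PIWA.empRisk f S x0 - PIWA.empRisk f S xs ≤ ε₀)
    (hPL : PIWA.PLOn μ Ω (PIWA.empRisk f S) xs)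
    (hρμ : ρ ≤ μ / 4)
    -- the parameters of the algorithm
    (α δ c d γ Ghat : ℝ) (e η D : ℕ → ℝ) (T : ℕ → ℕ)
    (hα : 0 ≤ α) (hδ0 : 0 < δ) (hδ1 : δ < 1)
    (he : ∀ k, e k = ε₀ / 2 ^ k)
    (hγ : γ = 4 / μ)
    (hD : ∀ k, D (k + 1) = Real.sqrt (e k / μ))
    (hGhat0 : 0 < Ghat) (hGhat : 2 * G ^ 2 + 2 * (γ⁻¹) ^ 2 * (D 1) ^ 2 ≤ Ghat ^ 2)
    (hc0 : 0 < c) (hc : c ≤ min 1 (2 * Ghat ^ 2 / (L * ε₀)))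
    (hd : d = max (32 * (α + 1) * Ghat ^ 2 / c)
      (512 * (α + 1) ^ 2 * Ghat ^ 2 * Real.log (1 / δ)))
    (hη : ∀ k, η k = e k * c / (2 * Ghat ^ 2))
    (hT : ∀ k, T k = ⌈d / (μ * e k)⌉₊)
    -- the target accuracy and the number of stages
    (ε : ℝ) (hε : 0 < ε) (K : ℕ) (hK : K = ⌈Real.logb 2 (ε₀ / ε)⌉₊)
    -- the sampled indices are independent and uniform
    {W : Type*} [MeasurableSpace W] (P : Measure W) [IsProbabilityMeasure P]
    (idx : ℕ → ℕ → W → Fin n) (hidx : ∀ k t, Measurable (idx k t))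
    (hindep : iIndepFun (fun p : ℕ × ℕ => idx p.1 p.2) P)
    (hunif : ∀ k t i, P.real {ω | idx k t ω = i} = 1 / (n : ℝ)) :
    (1 - δ) ^ K ≤ P.real {ω |
        PIWA.empRisk f S
            (PIWA.stagewise f S Ω α γ η D T x0 (fun k t => idx k t ω) K)
          - PIWA.empRisk f S xs ≤ ε} ∧
      ∑ k ∈ Finset.Icc 1 K, (T k : ℝ) ≤
        5 * Ghat ^ 2 * max (32 / c) (512 * (α + 1) * Real.log (1 / δ)) *
          ((α + 1) / (μ * ε)) := by
  have hn : 0 < n := by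
    obtain ⟨ω⟩ : Nonempty W := by
      by_contra h
      rw [not_nonempty_iff] at h
      have := measure_univ (μ := P)
      simp [Set.eq_empty_of_isEmpty] at this
    exact (idx 0 0 ω).pos
  have he0 : ∀ k, 0 < e k := fun k => by rw [he]; positivity
  have hesucc : ∀ k, e k = 2 * e (k + 1) := fun k => by rw [he, he, pow_succ]; field_simp
  have hele : ∀ k, e k ≤ e 0 := fun k => by
    rw [he, he, pow_zero, div_one]
    exact div_le_self hε₀.le (one_le_pow₀ one_le_two)
  have hc1 : c ≤ 1 := hc.trans (min_le_left _ _)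
  have hb : 1 / (2 * γ) = μ / 8 := by rw [hγ]; field_simp; norm_num
  have hγb : γ⁻¹ = 2 * (1 / (2 * γ)) := by rw [hb, hγ]; field_simp; norm_num
  have hdiff : ∀ z, ∀ x ∈ Ω, DifferentiableAt ℝ (f z) x := fun z => (hsmooth z).1
  have hd1 : 32 * (α + 1) * Ghat ^ 2 / c ≤ d := hd ▸ le_max_left _ _
  have hd0 : 0 < d := lt_of_lt_of_le (by positivity) hd1
  have hDsq : ∀ k, D (k + 1) ^ 2 = e k / μ := fun k => by
    rw [hD, Real.sq_sqrt (div_nonneg (he0 k).le hμ.le)]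
  have hTpos : ∀ k, 0 < T k := fun k => by
    rw [hT, Nat.ceil_pos]
    exact div_pos hd0 (mul_pos hμ (he0 k))
  set Y : ℕ × ℕ → W → Fin n := fun q => idx q.1 q.2 with hY
  set x : ℕ → (ℕ × ℕ → Fin n) → PIWA.Vec m := fun k J =>
    PIWA.stagewise f S Ω α γ η D T x0 (fun k t => J (k, t)) k with hx
  have hxΩ : ∀ k J, x k J ∈ Ω := fun k J => PIWA.stagewise_mem hΩc hΩ
    (fun k => hD k ▸ Real.sqrt_nonneg _) hTpos hx0 _ k
  -- stage `k + 1` rarely fails after a success of stage `k`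
  have hfail : ∀ k, P.real {ω |
      PIWA.empRisk f S (x k fun q => Y q ω) - PIWA.empRisk f S xs ≤ 2 * e (k + 1) ∧
        e (k + 1) < PIWA.empRisk f S (x (k + 1) fun q => Y q ω) - PIWA.empRisk f S xs} ≤
      δ * P.real {ω |
        PIWA.empRisk f S (x k fun q => Y q ω) - PIWA.empRisk f S xs ≤ 2 * e (k + 1)} := by
    intro k
    obtain ⟨T', hT'⟩ := Nat.exists_eq_add_of_lt (hTpos (k + 1))
    rw [zero_add] at hT'
    refine PIWA.stage_failure_le hΩc hΩ hmin hn hμ hG hweak hdiff hPL hρμ hb hα hδ0 hc0 hc1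
      (he0 (k + 1)) (D := D (k + 1)) (η := η (k + 1)) (c := c) (d := d) (T := T')
      (by rw [hD, hesucc]) hGhat0 ?_ (hη (k + 1)) hd ?_ (fun q => hidx q.1 q.2) hindep
      (fun q i => hunif q.1 q.2 i) (PIWA.finite_index_set T k)
      (PIWA.dependsOn_stagewise f S Ω α γ η D T x0 k) (hxΩ k) (p := fun t => (k + 1, t))
      (fun t t' h => congrArg Prod.snd h) (fun t h => absurd h.1 (by simp)) ?_
    · rw [← hγb]
      refine le_trans ?_ hGhat
      have : D (k + 1) ^ 2 ≤ D 1 ^ 2 := by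
        have h1 := hDsq 0
        rw [zero_add] at h1
        rw [hDsq, h1]
        exact div_le_div_of_nonneg_right (hele k) hμ.le
      gcongr
    · have := Nat.le_ceil (d / (μ * e (k + 1)))
      rw [← hT, hT'] at this
      exact_mod_cast this
    · funext J
      simp only [hx, PIWA.stagewise, hT']
      rfl
  have hprob : ∀ k, (1 - δ) ^ k ≤ P.real {ω |
      PIWA.empRisk f S (x k fun q => Y q ω) - PIWA.empRisk f S xs ≤ e k} := by
    intro k
    induction k with
    | zero =>
      have : {ω | PIWA.empRisk f S (x 0 fun q => Y q ω) - PIWA.empRisk f S xs ≤ e 0} =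
          Set.univ := by
        refine Set.eq_univ_of_forall fun ω => ?_
        simpa [hx, PIWA.stagewise, he] using hinit
      rw [this]
      simp
    | succ k ih =>
      have h1 := hfail k
      rw [← hesucc] at h1
      have h2 : P.real {ω |
          PIWA.empRisk f S (x k fun q => Y q ω) - PIWA.empRisk f S xs ≤ e k} ≤
          P.real {ω |
            PIWA.empRisk f S (x (k + 1) fun q => Y q ω) - PIWA.empRisk f S xs ≤ e (k + 1)} +
          P.real {ω |
            PIWA.empRisk f S (x k fun q => Y q ω) - PIWA.empRisk f S xs ≤ e k ∧
            e (k + 1) < PIWA.empRisk f S (x (k + 1) fun q => Y q ω) -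
              PIWA.empRisk f S xs} := by
        refine le_trans (measureReal_mono fun ω hω => ?_) (measureReal_union_le _ _)
        rcases le_or_gt (PIWA.empRisk f S (x (k + 1) fun q => Y q ω) - PIWA.empRisk f S xs)
          (e (k + 1)) with h | h
        · exact Or.inl h
        · exact Or.inr ⟨hω, h⟩
      rw [pow_succ']
      have h3 := mul_le_mul_of_nonneg_left ih (sub_nonneg.2 hδ1.le)
      linarith
  have heK : e K ≤ ε := by
    have h1 : Real.logb 2 (ε₀ / ε) ≤ (K : ℝ) := hK ▸ Nat.le_ceil _
    rw [Real.logb_le_iff_le_rpow one_lt_two (by positivity), Real.rpow_natCast,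
      div_le_iff₀ hε] at h1
    rw [he, div_le_iff₀ (by positivity)]
    linarith
  refine ⟨(hprob K).trans (measureReal_mono fun ω hω => ?_), ?_⟩
  · exact le_trans (b := e K) hω heK
  · -- `Ghat ^ 2` dominates the squared gradient of the first regulariser on its ball
    have hGε : μ * ε₀ ≤ 8 * Ghat ^ 2 := by
      have h1 := hDsq 0
      rw [zero_add, he, pow_zero, div_one] at h1
      have h2 : 2 * γ⁻¹ ^ 2 * D 1 ^ 2 = μ * ε₀ / 8 := by
        rw [h1, hγ]; field_simp; norm_num
      linarith [sq_nonneg G]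
    have hd4 : 4 * μ * ε₀ ≤ d := by
      refine le_trans ?_ hd1
      rw [le_div_iff₀ hc0]
      have h2 : 4 * μ * ε₀ * c ≤ 4 * μ * ε₀ := mul_le_of_le_one_right (by positivity) hc1
      nlinarith [mul_nonneg hα (sq_nonneg Ghat)]
    refine (PIWA.sum_iterations_le hμ hε₀ hε hd4 (fun k => by rw [hT, he]) hK).trans_eq ?_
    have h1 : d = (α + 1) * Ghat ^ 2 * max (32 / c) (512 * (α + 1) * Real.log (1 / δ)) := by
      rw [hd, mul_max_of_nonneg _ _ (by positivity)]
      congr 1 <;> ring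
    rw [h1]
    ring
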